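/- Let $\nu$ be a Radon measure on $(0,\infty)$ (finite on compact subsets of $(0,\infty)$), let $F$ be a probability measure on $(0,\infty)$, and let $\rho$ be the measure on $(0,\infty)$ given by $$\rho(A)=\int_0^\infty\int_0^\infty \mathbf 1_A(wy)\,F(dw)\,\nu(dy),\qquad A\in\mathcal B((0,\infty)).$$ Suppose that $\rho$ is a Lévy measure, i.e. $\int_{(0,1]}x^2\,\rho(dx)<\infty$ and $\rho((1,\infty))<\infty$, and that $\int_{(0,1]}x\,\rho(dx)<\infty$. Then there are, on some probability space, random variables $(P_i)_{i\ge1}$ listing the points of a Poisson process on $(0,\infty)$ of intensity $\nu$, and an i.i.d. sequence $(W_i)_{i\ge1}$ with distribution $F$, independent of the sequence $(P_i)_{i\ge1}$. (If the process has only finitely many points, the list is continued by zeros: $P_i=0$ means that there is no $i$-th point.) Moreover, for every such pair of sequences on any probability space, where the points of the process may be listed in any measurable order and zeros may be inserted anywhere in the list, the series $\sum_{i\ge1}P_iW_i$ converges almost surely, its sum is infinitely divisible with characteristic function $$u\mapsto\exp\Big\{\int_0^\infty(e^{iux}-1)\,\rho(dx)\Big\},\qquad u\in\mathbb R,$$ and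 every infinitely divisible real random variable $X$ with this characteristic function admits the representation $$X\stackrel{d}{=}\sum_{i\ge1}P_iW_i .$$ -/

import Mathlib

open MeasureTheory ProbabilityTheory
open scoped ENNReal NNReal

/-- The half-line `(0, ∞)`, with the topology and Borel sets induced from `ℝ`. -/
abbrev PosReal : Type := {x : ℝ // 0 < x}

/-- A Radon point measure: finite and integer valued on every Borel set that lies in a compact set
(for `(0, ∞)` these are the Borel sets bounded away from `0` and from `∞`). -/
def IsPointMeasure {E : Type*} [TopologicalSpace E] [MeasurableSpace E] (m : Measure E) : Prop :=
  ∀ B K : Set E, MeasurableSet B → IsCompact K → B ⊆ K → ∃ n : ℕ, m B = n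

/-- `N` is a Poisson process with intensity `ν` on the probability space `(Ω, P)`: a random Radon
point measure such that `N(B)` is Poisson distributed with mean `ν(B)` whenever `ν(B)` is finite,
and whose values on pairwise disjoint Borel sets are independent. -/
structure IsPoissonProcess {E Ω : Type*} [TopologicalSpace E] [MeasurableSpace E]
    [MeasurableSpace Ω] (ν : Measure E) (N : Ω → Measure E) (P : Measure Ω) : Prop where
  measurable : Measurable N
  isPointMeasure : ∀ ω, IsPointMeasure (N ω)
  map_eq_poisson : ∀ B : Set E, MeasurableSet B → ν B < ∞ →
    P.map (fun ω => N ω B) = (poissonMeasure (ν B).toNNReal).map (fun n : ℕ => (n : ℝ≥0∞))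
  indep : ∀ (k : ℕ) (B : Fin k → Set E), (∀ i, MeasurableSet (B i)) →
    Pairwise (fun i j => Disjoint (B i) (B j)) → iIndepFun (fun i ω => N ω (B i)) P

/-- The point measure `∑ δ_{p i}` on `(0, ∞)`, over the indices `i` with `p i > 0`.
The value `p i = 0` encodes that there is no `i`-th point, so that finite configurations are
also listed by infinite sequences. -/
noncomputable def pointMeasureOf (p : ℕ → ℝ) : Measure PosReal :=
  Measure.sum fun i => if h : 0 < p i then Measure.dirac (⟨p i, h⟩ : PosReal) else 0

/-- The random variables `p 0, p 1, …` are the points (padded by zeros) of a Poisson process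
on `(0, ∞)` with intensity `ν`. -/
structure IsPoissonPoints {Ω : Type*} [MeasurableSpace Ω] (ν : Measure PosReal)
    (p : ℕ → Ω → ℝ) (P : Measure Ω) : Prop where
  measurable : ∀ i, Measurable (p i)
  nonneg : ∀ i ω, 0 ≤ p i ω
  isPoissonProcess : IsPoissonProcess ν (fun ω => pointMeasureOf fun i => p i ω) P

/-- `p` lists the points of a Poisson process with intensity `ν`, and `W` is an i.i.d. sequence
with distribution `F` that is independent of the sequence `p`. -/
structure IsMarkedPoissonPoints {Ω : Type*} [MeasurableSpace Ω] (ν F : Measure PosReal)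
    (p : ℕ → Ω → ℝ) (W : ℕ → Ω → PosReal) (P : Measure Ω) : Prop where
  points : IsPoissonPoints ν p P
  measurable : ∀ i, Measurable (W i)
  law : ∀ i, P.map (W i) = F
  iIndep : iIndepFun W P
  indep : IndepFun (fun ω i => p i ω) (fun ω i => W i ω) P

/-- A Lévy measure on `(0, ∞)`. -/
def IsLevyMeasure (ρ : Measure PosReal) : Prop :=
  (∫⁻ x in {x : PosReal | (x : ℝ) ≤ 1}, ENNReal.ofReal ((x : ℝ) ^ 2) ∂ρ) < ∞ ∧
    ρ {x : PosReal | 1 < (x : ℝ)} < ∞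

/-- An infinitely divisible probability law on `ℝ`: for each `n ≥ 1` it is the law of a sum of `n`
i.i.d. random variables. -/
def IsInfinitelyDivisible (μ : Measure ℝ) : Prop :=
  IsProbabilityMeasure μ ∧ ∀ n : ℕ, 1 ≤ n → ∃ μn : Measure ℝ, IsProbabilityMeasure μn ∧
    (Measure.pi fun _ : Fin n => μn).map (fun x => ∑ i, x i) = μ

/-- `X` has characteristic function `u ↦ exp (∫ (e^{iux} - 1) ρ(dx))`. -/
def HasLevyCharFun {Ω : Type*} [MeasurableSpace Ω] (ρ : Measure PosReal)
    (X : Ω → ℝ) (P : Measure Ω) : Prop :=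
  ∀ u : ℝ, ∫ ω, Complex.exp (Complex.I * u * X ω) ∂P =
    Complex.exp (∫ x : PosReal, (Complex.exp (Complex.I * u * ((x : ℝ) : ℂ)) - 1) ∂ρ)

/-! Everything runs through Laplace transforms with values in `[0, ∞]`, where nonnegative series
always have a sum and `e^{-∞} = 0`. For σ-finite `ν`, a random point measure `N` is a Poisson
process exactly when E exp(-∫ f dN) = exp(-∫ (1 - e^{-f}) dν) for all measurable f ≥ 0
(`IsPoissonProcess.lintegral_negExp_lintegral`, `isPoissonProcess_of_lintegral_negExp`). Given the
points, the marks are i.i.d., so the conditional transform of S = ∑ P_i W_i at t is the product of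
the φ(P_i), where φ(y) = E e^{-tyW}; this is exp(-∫ f dN) with f = -log φ. Hence E e^{-tS} = exp(-∫
(1 - e^{-tx}) ρ(dx)) (`IsMarkedPoissonPoints.lintegral_negExp`). Only the point measure enters, so
the order of the list and inserted zeros are irrelevant.

The hypotheses on `ρ` give ∫ min(1, x) ρ(dx) < ∞. Letting t → 0 then shows S < ∞ almost surely. The
same bound makes both sides holomorphic in z = -t on Re z < 0, with the expected limits at z = iu;
they agree on the negative reals, hence at iu (`one_add_integral_cexp_eq`). Characteristic functions
determine laws, which yields the representation of X. Replacing `ν` by ν/n takes the n-th root of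
the characteristic function, which yields infinite divisibility.

The process itself is built on countably many disjoint shells of finite intensity
(`exists_isPoissonPoints`). -/

/-! ### The exponential `e^{-x}` on `[0, ∞]` -/

/-- The map `x ↦ e^{-x}` from `[0, ∞]` to `[0, 1]`. -/
noncomputable def negExp (x : ℝ≥0∞) : ℝ≥0∞ := EReal.exp (-(x : EReal))

@[simp] lemma negExp_zero : negExp 0 = 1 := by simp [negExp]

@[simp] lemma negExp_top : negExp ∞ = 0 := by simp [negExp]

lemma negExp_ofReal {x : ℝ} (hx : 0 ≤ x) :
    negExp (ENNReal.ofReal x) = ENNReal.ofReal (Real.exp (-x)) := by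
  rw [negExp, EReal.coe_ennreal_ofReal, max_eq_left hx, ← EReal.coe_neg, EReal.exp_coe]

lemma negExp_eq_of_ne_top {x : ℝ≥0∞} (hx : x ≠ ∞) :
    negExp x = ENNReal.ofReal (Real.exp (-x.toReal)) := by
  rw [← negExp_ofReal ENNReal.toReal_nonneg, ENNReal.ofReal_toReal hx]

lemma negExp_add (x y : ℝ≥0∞) : negExp (x + y) = negExp x * negExp y := by
  rcases eq_or_ne x ∞ with rfl | hx
  · simp
  rcases eq_or_ne y ∞ with rfl | hy
  · simp
  rw [negExp_eq_of_ne_top hx, negExp_eq_of_ne_top hy, negExp_eq_of_ne_top (by simp [hx, hy]),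
    ENNReal.toReal_add hx hy, neg_add, Real.exp_add, ENNReal.ofReal_mul (Real.exp_nonneg _)]

lemma negExp_sum {ι : Type*} (s : Finset ι) (f : ι → ℝ≥0∞) :
    negExp (∑ i ∈ s, f i) = ∏ i ∈ s, negExp (f i) := by
  classical
  induction s using Finset.induction_on with
  | empty => simp
  | insert a s ha ih => rw [Finset.sum_insert ha, Finset.prod_insert ha, negExp_add, ih]

lemma negExp_mul_natCast (x : ℝ≥0∞) (n : ℕ) : negExp (x * n) = negExp x ^ n := by
  simpa [mul_comm] using negExp_sum (Finset.range n) (fun _ => x)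

lemma negExp_antitone : Antitone negExp := fun x y h =>
  EReal.exp_monotone (EReal.neg_le_neg_iff.2 (by exact_mod_cast h))

lemma negExp_le_one (x : ℝ≥0∞) : negExp x ≤ 1 := by
  simpa using negExp_antitone (zero_le (a := x))

lemma negExp_ne_top (x : ℝ≥0∞) : negExp x ≠ ∞ :=
  ((negExp_le_one x).trans_lt ENNReal.one_lt_top).ne

lemma continuous_negExp : Continuous negExp :=
  ENNReal.continuous_exp.comp (continuous_neg.comp continuous_coe_ennreal_ereal)

lemma measurable_negExp : Measurable negExp := continuous_negExp.measurable

@[fun_prop]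
lemma Measurable.negExp {α : Type*} [MeasurableSpace α] {f : α → ℝ≥0∞} (hf : Measurable f) :
    Measurable fun x => negExp (f x) := measurable_negExp.comp hf

lemma negExp_injective : Function.Injective negExp := fun x y h => by
  have := EReal.exp_strictMono.injective h
  simpa using this

/-- The inverse of `negExp` on `[0, 1]`. -/
noncomputable def negLog (x : ℝ≥0∞) : ℝ≥0∞ := (-(ENNReal.log x)).toENNReal

lemma negExp_negLog {x : ℝ≥0∞} (hx : x ≤ 1) : negExp (negLog x) = x := by
  have : 0 ≤ -(ENNReal.log x) := by simpa [EReal.neg_nonneg] using hx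
  rw [negExp, negLog, EReal.coe_toENNReal this, neg_neg, ENNReal.exp_log]

lemma measurable_negLog : Measurable negLog :=
  (ENNReal.measurable_log.neg).ereal_toENNReal

/-! ### Laplace transforms of `[0, ∞]`-valued variables -/

lemma lintegral_negExp_le_one {Ω : Type*} [MeasurableSpace Ω] (P : Measure Ω)
    [IsProbabilityMeasure P] (X : Ω → ℝ≥0∞) : ∫⁻ ω, negExp (X ω) ∂P ≤ 1 := by
  simpa using lintegral_mono (μ := P) (fun ω => negExp_le_one (X ω))

/-- The probability generating function of the Poisson distribution. -/
lemma lintegral_pow_poissonMeasure (r : ℝ≥0) {s : ℝ≥0∞} (hs : s ≤ 1) :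
    ∫⁻ n, s ^ n ∂(poissonMeasure r) = negExp (r * (1 - s)) := by
  lift s to ℝ≥0 using (hs.trans_lt ENNReal.one_lt_top).ne
  have hs' : (s : ℝ) ≤ 1 := by exact_mod_cast hs
  have h1 : (r : ℝ≥0∞) * (1 - s) = ENNReal.ofReal ((r : ℝ) * (1 - (s : ℝ))) := by
    rw [ENNReal.ofReal_mul r.coe_nonneg, ENNReal.ofReal_sub _ s.coe_nonneg]; simp
  rw [h1, negExp_ofReal (mul_nonneg r.coe_nonneg (by linarith)), poissonMeasure,
    lintegral_sum_measure]
  have h2 : ∀ n : ℕ, ∫⁻ k, (s : ℝ≥0∞) ^ k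
      ∂(ENNReal.ofReal (Real.exp (-r) * r ^ n / (n.factorial)) • Measure.dirac n)
      = ENNReal.ofReal (Real.exp (-r) * ((r * s) ^ n / n.factorial)) := fun n => by
    rw [lintegral_smul_measure, lintegral_dirac, smul_eq_mul, ← ENNReal.ofReal_coe_nnreal (p := s),
      ← ENNReal.ofReal_pow s.coe_nonneg, ← ENNReal.ofReal_mul (by positivity)]
    congr 1; ring
  have h3 := (NormedSpace.expSeries_div_hasSum_exp ((r : ℝ) * s)).mul_left (Real.exp (-r))
  simp_rw [h2]
  rw [← ENNReal.ofReal_tsum_of_nonneg (fun n => by positivity) h3.summable, h3.tsum_eq,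
    ← Real.exp_eq_exp_ℝ, ← Real.exp_add]
  congr 2; ring

open Filter Topology in
/-- The Laplace transform of a series of independent variables. -/
lemma lintegral_negExp_tsum {Ω : Type*} [MeasurableSpace Ω] {P : Measure Ω}
    [IsProbabilityMeasure P] {Y : ℕ → Ω → ℝ≥0∞} (hY : iIndepFun Y P) (hm : ∀ i, Measurable (Y i))
    {a : ℕ → ℝ≥0∞} (ha : ∀ i, ∫⁻ ω, negExp (Y i ω) ∂P = negExp (a i)) :
    ∫⁻ ω, negExp (∑' i, Y i ω) ∂P = negExp (∑' i, a i) := by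
  have h1 : ∀ n : ℕ, ∫⁻ ω, negExp (∑ i ∈ Finset.range n, Y i ω) ∂P
      = negExp (∑ i ∈ Finset.range n, a i) := fun n => by
    simp_rw [negExp_sum]
    have := lintegral_prod_eq_prod_lintegral_of_indepFun (Finset.range n)
      (fun i ω => negExp (Y i ω)) (hY.comp (fun _ => negExp) (fun _ => measurable_negExp))
      (fun i => measurable_negExp.comp (hm i))
    rw [this]
    simp_rw [ha]
  have h2 : Tendsto (fun n => ∫⁻ ω, negExp (∑ i ∈ Finset.range n, Y i ω) ∂P) atTop
      (𝓝 (∫⁻ ω, negExp (∑' i, Y i ω) ∂P)) := by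
    refine tendsto_lintegral_of_dominated_convergence (fun _ => 1)
      (fun n => measurable_negExp.comp (Finset.measurable_sum _ fun i _ => hm i))
      (fun n => ae_of_all _ fun ω => negExp_le_one _) (by simp) (ae_of_all _ fun ω => ?_)
    exact (continuous_negExp.tendsto _).comp (ENNReal.tendsto_nat_tsum _)
  simp_rw [h1] at h2
  exact tendsto_nhds_unique h2 ((continuous_negExp.tendsto _).comp (ENNReal.tendsto_nat_tsum _))

/-- Finite measures on `[0, ∞]^k` are determined by their Laplace transforms. -/
lemma ext_of_lintegral_negExp {k : ℕ} {μ μ' : Measure (Fin k → ℝ≥0∞)} [IsFiniteMeasure μ]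
    [IsFiniteMeasure μ']
    (h : ∀ m : Fin k → ℕ, ∫⁻ x, negExp (∑ i, m i * x i) ∂μ = ∫⁻ x, negExp (∑ i, m i * x i) ∂μ') :
    μ = μ' := by
  let Φ : Multiplicative (Fin k → ℕ) →* BoundedContinuousFunction (Fin k → ℝ≥0∞) ℝ :=
    { toFun := fun m => BoundedContinuousFunction.ofNormedAddCommGroup
        (fun x => (negExp (∑ i, (m.toAdd i : ℝ≥0∞) * x i)).toReal)
        (ENNReal.continuousOn_toReal.comp_continuous (continuous_negExp.comp
          (continuous_finsetSum _ fun i _ =>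
            (ENNReal.continuous_const_mul (ENNReal.natCast_ne_top _)).comp (continuous_apply i)))
          fun x => negExp_ne_top _) 1 (fun x => by
            rw [Real.norm_of_nonneg ENNReal.toReal_nonneg]
            exact ENNReal.toReal_le_of_le_ofReal zero_le_one (by simpa using negExp_le_one _))
      map_one' := by ext x; simp
      map_mul' := fun m m' => by
        ext x
        simp [add_mul, Finset.sum_add_distrib, negExp_add] }
  have hΦ : ∀ m x, Φ m x = (negExp (∑ i, (m.toAdd i : ℝ≥0∞) * x i)).toReal := fun m x => rfl
  let A : StarSubalgebra ℝ (BoundedContinuousFunction (Fin k → ℝ≥0∞) ℝ) :=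
    { Algebra.adjoin ℝ (MonoidHom.mrange Φ : Set _) with
      star_mem' := fun {a} ha => by
        have : star a = a := by ext x; simp
        rwa [this] }
  -- The exponentials are closed under products, so the algebra they generate is their linear span
  -- and equality of integrals need only be checked on them.
  have hA : ∀ g, g ∈ A ↔ g ∈ Submodule.span ℝ (MonoidHom.mrange Φ : Set _) := fun g => by
    change g ∈ Subalgebra.toSubmodule (Algebra.adjoin ℝ (MonoidHom.mrange Φ : Set _)) ↔ _
    rw [Algebra.adjoin_eq_span, Submonoid.closure_eq]
  refine ext_of_forall_mem_subalgebra_integral_eq_of_polish (𝕜 := ℝ) (A := A) ?_ ?_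
  · intro x y hxy
    obtain ⟨i, hi⟩ := Function.ne_iff.1 hxy
    refine ⟨Φ (Multiplicative.ofAdd (Pi.single i 1)), ⟨Φ (Multiplicative.ofAdd (Pi.single i 1)),
      ⟨_, (hA _).2 (Submodule.subset_span ⟨_, rfl⟩), rfl⟩, rfl⟩, fun h' => hi ?_⟩
    rw [hΦ, hΦ, ENNReal.toReal_eq_toReal_iff' (negExp_ne_top _) (negExp_ne_top _)] at h'
    simpa [Pi.single_apply] using negExp_injective h'
  · intro g hg
    rw [hA] at hg
    induction hg using Submodule.span_induction with
    | mem g hg =>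
      obtain ⟨m, rfl⟩ := hg
      simp_rw [hΦ]
      rw [integral_toReal, integral_toReal, h]
      all_goals first
        | exact ae_of_all _ fun x => (negExp_le_one _).trans_lt ENNReal.one_lt_top
        | exact (measurable_negExp.comp (Finset.measurable_sum _ fun i _ =>
            (measurable_pi_apply i).const_mul _)).aemeasurable
    | zero => simp
    | add f g _ _ hf hg =>
      simp only [BoundedContinuousFunction.coe_add, Pi.add_apply]
      rw [integral_add (f.integrable _) (g.integrable _),
        integral_add (f.integrable _) (g.integrable _), hf, hg]
    | smul c f _ hf =>
      simp only [BoundedContinuousFunction.coe_smul]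
      rw [integral_smul, integral_smul, hf]

open Filter Topology in
lemma tendsto_setLIntegral_of_monotone {E : Type*} [MeasurableSpace E] (μ : Measure E)
    {S : ℕ → Set E} (hS : Monotone S) (hSm : ∀ n, MeasurableSet (S n)) (hU : ⋃ n, S n = Set.univ)
    {g : ℕ → E → ℝ≥0∞} (hg : ∀ n, Measurable (g n)) (hmono : ∀ x, Monotone fun n => g n x)
    {G : E → ℝ≥0∞} (hG : ∀ x, Tendsto (fun n => g n x) atTop (𝓝 (G x))) :
    Tendsto (fun n => ∫⁻ x in S n, g n x ∂μ) atTop (𝓝 (∫⁻ x, G x ∂μ)) := by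
  simp_rw [← lintegral_indicator (hSm _)]
  refine lintegral_tendsto_of_tendsto_of_monotone
    (fun n => ((hg n).indicator (hSm n)).aemeasurable) (ae_of_all _ fun x n m hnm => ?_)
    (ae_of_all _ fun x => ?_)
  · by_cases hx : x ∈ S n
    · simpa [hx, hS hnm hx] using hmono x hnm
    · simp [hx]
  · obtain ⟨n, hn⟩ := Set.mem_iUnion.1 (hU.symm ▸ Set.mem_univ x : x ∈ ⋃ n, S n)
    refine (hG x).congr' ?_
    filter_upwards [eventually_ge_atTop n] with m hm
    simp [hS hm hn]

/-- At most one indicator is nonzero at `x`. This additivity is what makes the joint transform of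
counts on disjoint sets factorise. -/
lemma one_sub_negExp_sum_indicator {ι E : Type*} [Fintype ι] {B : ι → Set E}
    (hB : Pairwise fun i j => Disjoint (B i) (B j)) (m : ι → ℝ≥0∞) (x : E) :
    1 - negExp (∑ i, (B i).indicator (fun _ => m i) x)
      = ∑ i, (1 - negExp ((B i).indicator (fun _ => m i) x)) := by
  by_cases hx : ∃ j, x ∈ B j
  · obtain ⟨j, hj⟩ := hx
    have h0 : ∀ i, i ≠ j → (B i).indicator (fun _ => m i) x = 0 := fun i hi =>
      Set.indicator_of_notMem (fun hxi => Set.disjoint_left.1 (hB hi) hxi hj) _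
    rw [Finset.sum_eq_single j (fun i _ hi => h0 i hi) (by simp),
      Finset.sum_eq_single j (fun i _ hi => by simp [h0 i hi]) (by simp)]
  · push Not at hx
    simp [hx]

/-! ### The Laplace functional characterises Poisson processes -/

section PoissonProcess

variable {E Ω : Type*} [TopologicalSpace E] [MeasurableSpace E] [MeasurableSpace Ω]
  {ν : Measure E} {N : Ω → Measure E} {P : Measure Ω}

lemma IsPoissonProcess.measurable_apply (h : IsPoissonProcess ν N P) {B : Set E}
    (hB : MeasurableSet B) : Measurable fun ω => N ω B :=
  (Measure.measurable_coe hB).comp h.measurable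

lemma IsPoissonProcess.lintegral_negExp_mul_apply (h : IsPoissonProcess ν N P) {B : Set E}
    (hB : MeasurableSet B) (hν : ν B < ∞) (c : ℝ≥0∞) :
    ∫⁻ ω, negExp (c * N ω B) ∂P = negExp ((1 - negExp c) * ν B) := by
  have hc : Measurable fun x => negExp (c * x) := measurable_negExp.comp (measurable_id.const_mul c)
  have h1 : ∫⁻ ω, negExp (c * N ω B) ∂P = ∫⁻ x, negExp (c * x) ∂(P.map fun ω => N ω B) :=
    (lintegral_map hc (h.measurable_apply hB)).symm
  rw [h1, h.map_eq_poisson B hB hν, lintegral_map hc (by fun_prop)]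
  simp_rw [negExp_mul_natCast]
  rw [lintegral_pow_poissonMeasure _ (negExp_le_one c), ENNReal.coe_toNNReal hν.ne, mul_comm]

/-- The level sets of `f` in `K` are disjoint with finite intensity, so their counts are independent
Poisson variables and the transform is a finite product. -/
lemma IsPoissonProcess.lintegral_negExp_simpleFunc (h : IsPoissonProcess ν N P)
    (f : SimpleFunc E ℝ≥0∞) {K : Set E} (hK : MeasurableSet K) (hν : ν K < ∞) :
    ∫⁻ ω, negExp (∫⁻ x in K, f x ∂(N ω)) ∂P = negExp (∫⁻ x in K, 1 - negExp (f x) ∂ν) := by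
  have hB : ∀ c : ℝ≥0∞, MeasurableSet (f ⁻¹' {c} ∩ K) := fun c =>
    (f.measurableSet_preimage _).inter hK
  have h1 : ∀ ω, ∫⁻ x in K, f x ∂(N ω) = ∑ c : f.range, (c : ℝ≥0∞) * N ω (f ⁻¹' {c.1} ∩ K) :=
    fun ω => by
      rw [SimpleFunc.lintegral_eq_lintegral, SimpleFunc.lintegral, ← Finset.sum_coe_sort]
      simp_rw [Measure.restrict_apply (f.measurableSet_preimage _)]
  have h2 : ∫⁻ x in K, 1 - negExp (f x) ∂ν
      = ∑ c : f.range, (1 - negExp c) * ν (f ⁻¹' {c.1} ∩ K) := by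
    have := SimpleFunc.map_lintegral (μ := ν.restrict K) (fun c => 1 - negExp c) f
    rw [← SimpleFunc.lintegral_eq_lintegral] at this
    simp only [SimpleFunc.map_apply] at this
    rw [this, ← Finset.sum_coe_sort]
    simp_rw [Measure.restrict_apply (f.measurableSet_preimage _)]
  have hind : iIndepFun (fun (c : f.range) ω => N ω (f ⁻¹' {c.1} ∩ K)) P := by
    have := h.indep _ (fun i => f ⁻¹' {(f.range.equivFin.symm i).1} ∩ K) (fun i => hB _) ?_
    · simpa using this.precomp f.range.equivFin.injective
    · intro i j hij
      refine Disjoint.mono Set.inter_subset_left Set.inter_subset_left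
        (Disjoint.preimage _ (Set.disjoint_singleton.2 fun h' => hij ?_))
      exact f.range.equivFin.symm.injective (Subtype.ext h')
  simp_rw [h1, h2, negExp_sum]
  rw [lintegral_prod_eq_prod_lintegral_of_indepFun Finset.univ
    (fun (c : f.range) ω => negExp (c * N ω (f ⁻¹' {c.1} ∩ K)))
    (hind.comp (fun c x => negExp (c * x))
      fun c => measurable_negExp.comp (measurable_id.const_mul _))
    (fun c => measurable_negExp.comp ((h.measurable_apply (hB _)).const_mul _))]
  exact Finset.prod_congr rfl fun c _ => h.lintegral_negExp_mul_apply (hB _)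
    ((measure_mono Set.inter_subset_right).trans_lt hν) _

open Filter Topology in
/-- The Laplace functional of a Poisson process. -/
theorem IsPoissonProcess.lintegral_negExp_lintegral [SigmaFinite ν] [IsProbabilityMeasure P]
    (h : IsPoissonProcess ν N P) {f : E → ℝ≥0∞} (hf : Measurable f) :
    ∫⁻ ω, negExp (∫⁻ x, f x ∂(N ω)) ∂P = negExp (∫⁻ x, 1 - negExp (f x) ∂ν) := by
  have hlim : ∀ x, Tendsto (fun n => SimpleFunc.eapprox f n x) atTop (𝓝 (f x)) := fun x => by
    have := tendsto_atTop_iSup (f := fun n => SimpleFunc.eapprox f n x)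
      fun n m hnm => SimpleFunc.monotone_eapprox f hnm x
    rwa [SimpleFunc.iSup_eapprox_apply hf] at this
  -- Values and domain grow together: simple functions increase to `f` while sets of finite
  -- intensity exhaust `E`. As `negExp ≤ 1`, dominated convergence applies even where the integral
  -- is infinite.
  have h1 : ∀ ω, Tendsto
      (fun n => negExp (∫⁻ x in spanningSets ν n, SimpleFunc.eapprox f n x ∂(N ω))) atTop
      (𝓝 (negExp (∫⁻ x, f x ∂(N ω)))) := fun ω =>
    (continuous_negExp.tendsto _).comp (tendsto_setLIntegral_of_monotone _
      (monotone_spanningSets ν) (measurableSet_spanningSets ν) (iUnion_spanningSets ν)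
      (fun n => SimpleFunc.measurable _) (fun x n m hnm => SimpleFunc.monotone_eapprox f hnm x)
      hlim)
  have h2 : Tendsto (fun n => ∫⁻ ω, negExp
      (∫⁻ x in spanningSets ν n, SimpleFunc.eapprox f n x ∂(N ω)) ∂P) atTop
      (𝓝 (∫⁻ ω, negExp (∫⁻ x, f x ∂(N ω)) ∂P)) := by
    refine tendsto_lintegral_of_dominated_convergence (fun _ => 1) (fun n => ?_)
      (fun n => ae_of_all _ fun ω => negExp_le_one _) (by simp) (ae_of_all _ h1)
    simp_rw [← lintegral_indicator (measurableSet_spanningSets ν n)]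
    exact measurable_negExp.comp ((Measure.measurable_lintegral
      ((SimpleFunc.measurable _).indicator (measurableSet_spanningSets ν n))).comp h.measurable)
  simp_rw [h.lintegral_negExp_simpleFunc _ (measurableSet_spanningSets ν _)
    (measure_spanningSets_lt_top ν _)] at h2
  refine tendsto_nhds_unique h2 ((continuous_negExp.tendsto _).comp
    (tendsto_setLIntegral_of_monotone _ (monotone_spanningSets ν) (measurableSet_spanningSets ν)
      (iUnion_spanningSets ν)
      (fun n => (measurable_negExp.comp (SimpleFunc.measurable _)).const_sub _)
      (fun x n m hnm => tsub_le_tsub_left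
        (negExp_antitone (SimpleFunc.monotone_eapprox f hnm x)) _) fun x => ?_))
  exact ENNReal.Tendsto.sub tendsto_const_nhds ((continuous_negExp.tendsto _).comp (hlim x))
    (Or.inl ENNReal.one_ne_top)

lemma ext_of_lintegral_negExp_mul {μ μ' : Measure ℝ≥0∞} [IsFiniteMeasure μ] [IsFiniteMeasure μ']
    (h : ∀ m : ℕ, ∫⁻ x, negExp (m * x) ∂μ = ∫⁻ x, negExp (m * x) ∂μ') : μ = μ' := by
  have hc : Measurable fun (x : ℝ≥0∞) (_ : Fin 1) => x := by fun_prop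
  have h1 : μ.map (fun x (_ : Fin 1) => x) = μ'.map (fun x (_ : Fin 1) => x) := by
    refine ext_of_lintegral_negExp fun m => ?_
    have hm : Measurable fun x : Fin 1 → ℝ≥0∞ => negExp (∑ i, m i * x i) :=
      measurable_negExp.comp (Finset.measurable_sum _ fun i _ =>
        (measurable_pi_apply i).const_mul _)
    rw [lintegral_map hm hc, lintegral_map hm hc]
    simpa using h (m 0)
  have h2 := congrArg (Measure.map fun x : Fin 1 → ℝ≥0∞ => x 0) h1
  rw [Measure.map_map (by fun_prop) hc, Measure.map_map (by fun_prop) hc] at h2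
  change μ.map id = μ'.map id at h2
  simpa using h2

/-- A random point measure is a Poisson process as soon as it has the right Laplace functional. -/
theorem isPoissonProcess_of_lintegral_negExp [IsProbabilityMeasure P] (hN : Measurable N)
    (hpm : ∀ ω, IsPointMeasure (N ω))
    (h : ∀ f : E → ℝ≥0∞, Measurable f →
      ∫⁻ ω, negExp (∫⁻ x, f x ∂(N ω)) ∂P = negExp (∫⁻ x, 1 - negExp (f x) ∂ν)) :
    IsPoissonProcess ν N P := by
  have hNB : ∀ {B : Set E}, MeasurableSet B → Measurable fun ω => N ω B := fun hB =>
    (Measure.measurable_coe hB).comp hN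
  have hind : ∀ {B : Set E} (c : ℝ≥0∞), MeasurableSet B →
      ∫⁻ ω, negExp (c * N ω B) ∂P
        = negExp (∫⁻ x, 1 - negExp (B.indicator (fun _ => c) x) ∂ν) := fun {B} c hB => by
    rw [← h _ (measurable_const.indicator hB)]
    simp_rw [lintegral_indicator_const hB]
  have hmm : ∀ m : ℝ≥0∞, Measurable fun x => negExp (m * x) := fun m =>
    measurable_negExp.comp (measurable_id.const_mul _)
  refine ⟨hN, hpm, fun B hB hν => ?_, fun k B hB hd => ?_⟩
  · have := Measure.isProbabilityMeasure_map (μ := P) (hNB hB).aemeasurable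
    refine ext_of_lintegral_negExp_mul fun m => ?_
    rw [lintegral_map (hmm _) (hNB hB), lintegral_map (hmm _) (by fun_prop), hind _ hB]
    simp_rw [negExp_mul_natCast]
    rw [lintegral_pow_poissonMeasure _ (negExp_le_one _), ENNReal.coe_toNNReal hν.ne, mul_comm,
      ← lintegral_indicator_const hB]
    congr 2 with x
    by_cases hx : x ∈ B <;> simp [hx]
  · have hprob : ∀ i, IsProbabilityMeasure (P.map fun ω => N ω (B i)) := fun i =>
      Measure.isProbabilityMeasure_map (hNB (hB i)).aemeasurable
    have hvec : Measurable fun ω (i : Fin k) => N ω (B i) :=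
      measurable_pi_lambda _ fun i => hNB (hB i)
    have := Measure.isProbabilityMeasure_map (μ := P) hvec.aemeasurable
    rw [iIndepFun_iff_map_fun_eq_pi_map fun i => (hNB (hB i)).aemeasurable]
    refine ext_of_lintegral_negExp fun m => ?_
    have hsum : Measurable fun x : Fin k → ℝ≥0∞ => negExp (∑ i, m i * x i) :=
      measurable_negExp.comp (Finset.measurable_sum _ fun i _ =>
        (measurable_pi_apply i).const_mul _)
    rw [lintegral_map hsum hvec]
    -- The test function ∑ m_i 1_{B_i} gives the joint transform of the counts. A set with `ν (B i)
    -- = ∞` needs no separate treatment.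
    have h1 := h (fun x => ∑ i, (B i).indicator (fun _ => (m i : ℝ≥0∞)) x)
      (Finset.measurable_sum _ fun i _ => measurable_const.indicator (hB i))
    simp_rw [lintegral_finsetSum Finset.univ
      (fun i _ => measurable_const.indicator (hB i)), lintegral_indicator_const (hB _),
      one_sub_negExp_sum_indicator hd] at h1
    rw [h1, lintegral_finsetSum Finset.univ fun i _ =>
      (measurable_const.indicator (hB i)).negExp.const_sub _]
    simp_rw [negExp_sum]
    rw [lintegral_prod_eq_prod_lintegral_of_indepFun Finset.univ _
      (iIndepFun_pi (X := fun i x => negExp (m i * x)) fun i => (hmm _).aemeasurable)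
      fun i => (hmm _).comp (measurable_pi_apply i)]
    refine Finset.prod_congr rfl fun i _ => ?_
    rw [(measurePreserving_eval (fun i => P.map fun ω => N ω (B i)) i).lintegral_comp (hmm (m i)),
      lintegral_map (hmm _) (hNB (hB i)), hind _ (hB i)]

end PoissonProcess

/-! ### Point measures of lists padded by zeros -/

/-- The extension of a function on `(0, ∞)` by zero. -/
noncomputable def zeroExtend (f : PosReal → ℝ≥0∞) (x : ℝ) : ℝ≥0∞ :=
  if h : 0 < x then f ⟨x, h⟩ else 0

@[simp] lemma zeroExtend_zero (f : PosReal → ℝ≥0∞) : zeroExtend f 0 = 0 := by simp [zeroExtend]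

@[simp] lemma zeroExtend_coe (f : PosReal → ℝ≥0∞) (x : PosReal) : zeroExtend f x = f x := by
  simp [zeroExtend, x.2]

@[fun_prop]
lemma measurable_zeroExtend {f : PosReal → ℝ≥0∞} (hf : Measurable f) :
    Measurable (zeroExtend f) := by
  classical
  exact Measurable.dite (s := {x : ℝ | 0 < x}) (f := f) (g := fun _ => (0 : ℝ≥0∞)) hf
    measurable_const measurableSet_Ioi

lemma lintegral_pointMeasureOf (p : ℕ → ℝ) {f : PosReal → ℝ≥0∞} (hf : Measurable f) :
    ∫⁻ x, f x ∂(pointMeasureOf p) = ∑' i, zeroExtend f (p i) := by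
  rw [pointMeasureOf, lintegral_sum_measure]
  refine tsum_congr fun i => ?_
  by_cases h : 0 < p i
  · simp [h, zeroExtend, lintegral_dirac' _ hf]
  · simp [h, zeroExtend]

lemma pointMeasureOf_apply (p : ℕ → ℝ) {B : Set PosReal} (hB : MeasurableSet B) :
    pointMeasureOf p B = ∑' i, zeroExtend (B.indicator 1) (p i) := by
  rw [← lintegral_pointMeasureOf p (measurable_one.indicator hB), lintegral_indicator_one hB]

lemma measurable_pointMeasureOf {Ω : Type*} [MeasurableSpace Ω] {p : ℕ → Ω → ℝ}
    (hp : ∀ i, Measurable (p i)) : Measurable fun ω => pointMeasureOf fun i => p i ω := by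
  refine Measure.measurable_of_measurable_coe _ fun B hB => ?_
  simp_rw [pointMeasureOf_apply _ hB]
  exact Measurable.tsum fun i =>
    (measurable_zeroExtend (measurable_one.indicator hB)).comp (hp i)

lemma pointMeasureOf_congr {p q : ℕ → ℝ}
    (h : ∀ g : ℝ → ℝ≥0∞, g 0 = 0 → ∑' i, g (p i) = ∑' i, g (q i)) :
    pointMeasureOf p = pointMeasureOf q := by
  ext B hB
  rw [pointMeasureOf_apply _ hB, pointMeasureOf_apply _ hB, h _ (zeroExtend_zero _)]

lemma isPointMeasure_pointMeasureOf {p : ℕ → ℝ}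
    (h : ∀ K : Set PosReal, IsCompact K → {i | p i ∈ Subtype.val '' K}.Finite) :
    IsPointMeasure (pointMeasureOf p) := by
  intro B K hB hK hBK
  have hval : ∀ i, ∃ n : ℕ, zeroExtend (B.indicator 1) (p i) = n := fun i => by
    by_cases hi : 0 < p i
    · by_cases hiB : (⟨p i, hi⟩ : PosReal) ∈ B
      · exact ⟨1, by simp [zeroExtend, hi, hiB]⟩
      · exact ⟨0, by simp [zeroExtend, hi, hiB]⟩
    · exact ⟨0, by simp [zeroExtend, hi]⟩
  choose n hn using hval
  refine ⟨∑ i ∈ (h K hK).toFinset, n i, ?_⟩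
  rw [pointMeasureOf_apply _ hB, tsum_eq_sum (s := (h K hK).toFinset) fun i hi => ?_]
  · simp [hn]
  · by_contra h0
    refine hi ((h K hK).mem_toFinset.2 ?_)
    by_cases hi : 0 < p i
    · refine ⟨⟨p i, hi⟩, hBK ?_, rfl⟩
      by_contra hiB
      simp [zeroExtend, hi, hiB] at h0
    · simp [zeroExtend, hi] at h0

/-! ### Existence of the Poisson points -/

/-- The index of the shell of `(0, ∞)` that contains `x`. -/
noncomputable def shellIndex (x : PosReal) : ℕ := ⌊max (x : ℝ) (x : ℝ)⁻¹⌋₊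

lemma measurable_shellIndex : Measurable shellIndex :=
  Nat.measurable_floor.comp (measurable_subtype_coe.max measurable_subtype_coe.inv)

lemma exists_shellIndex_le {K : Set PosReal} (hK : IsCompact K) :
    ∃ n, ∀ x ∈ K, shellIndex x ≤ n := by
  have hc : Continuous fun x : PosReal => max (x : ℝ) (x : ℝ)⁻¹ :=
    continuous_subtype_val.max (continuous_subtype_val.inv₀ fun x => x.2.ne')
  obtain ⟨C, hC⟩ := hK.bddAbove_image hc.continuousOn
  exact ⟨⌊C⌋₊, fun x hx => Nat.floor_mono (hC ⟨x, hx, rfl⟩)⟩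

/-- On this shell both `x` and `1/x` are below `n + 1`, so the shell lies in the compact interval
from `1/(n+1)` to `n + 1`. -/
lemma measure_shell_lt_top (ν : Measure PosReal) [IsFiniteMeasureOnCompacts ν] (n : ℕ) :
    ν (shellIndex ⁻¹' {n}) < ∞ := by
  have hpos : (0 : ℝ) < n + 1 := by positivity
  have hK : IsCompact {x : PosReal | (x : ℝ) ∈ Set.Icc ((n + 1 : ℝ)⁻¹) (n + 1)} := by
    rw [Subtype.isCompact_iff]
    convert (isCompact_Icc : IsCompact (Set.Icc ((n + 1 : ℝ)⁻¹) (n + 1))) using 1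
    ext x
    constructor
    · rintro ⟨y, hy, rfl⟩
      exact hy
    · exact fun hx => ⟨⟨x, (inv_pos.2 hpos).trans_le hx.1⟩, hx, rfl⟩
  refine (measure_mono fun x hx => ?_).trans_lt hK.measure_lt_top
  have h1 : max (x : ℝ) (x : ℝ)⁻¹ < n + 1 := by
    have := Nat.lt_floor_add_one (max (x : ℝ) (x : ℝ)⁻¹)
    rwa [show ⌊max (x : ℝ) (x : ℝ)⁻¹⌋₊ = n from hx] at this
  exact ⟨inv_le_of_inv_le₀ x.2 ((le_max_right _ _).trans h1.le), (le_max_left _ _).trans h1.le⟩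

instance sigmaFinite_of_isFiniteMeasureOnCompacts_posReal (ν : Measure PosReal)
    [IsFiniteMeasureOnCompacts ν] : SigmaFinite ν :=
  ⟨⟨{ set := fun n => shellIndex ⁻¹' {n}
      set_mem := fun _ => trivial
      finite := measure_shell_lt_top ν
      spanning := by ext x; simp }⟩⟩

/-- For zero mass any `κ` will do; shells of measure zero thus need no special case later. -/
lemma exists_isProbabilityMeasure_smul_eq {E : Type*} [MeasurableSpace E] [Nonempty E]
    (m : Measure E) [IsFiniteMeasure m] :
    ∃ κ : Measure E, IsProbabilityMeasure κ ∧ m Set.univ • κ = m := by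
  rcases eq_or_ne m 0 with rfl | hm
  · exact ⟨Measure.dirac (Classical.arbitrary E), inferInstance, by simp⟩
  · have : NeZero m := ⟨hm⟩
    refine ⟨(m Set.univ)⁻¹ • m, inferInstance, ?_⟩
    rw [smul_smul, ENNReal.mul_inv_cancel (by simpa using hm) (measure_ne_top _ _), one_smul]

/-- The Laplace transform of a sum of a Poisson number of i.i.d. terms. -/
lemma lintegral_negExp_compoundPoisson {E : Type*} [MeasurableSpace E] (r : ℝ≥0) (κ : Measure E)
    [IsProbabilityMeasure κ] {f : E → ℝ≥0∞} (hf : Measurable f) :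
    ∫⁻ z, negExp (∑' j, if j < z.1 then f (z.2 j) else 0)
        ∂((poissonMeasure r).prod (Measure.infinitePi fun _ : ℕ => κ))
      = negExp (r * ∫⁻ x, 1 - negExp (f x) ∂κ) := by
  have hs := lintegral_negExp_le_one κ f
  have hm : Measurable fun z : ℕ × (ℕ → E) =>
      negExp (∑' j, if j < z.1 then f (z.2 j) else 0) := by
    refine Measurable.negExp (Measurable.tsum fun j => ?_)
    exact Measurable.ite (measurableSet_lt measurable_const measurable_fst) (by fun_prop)
      measurable_const
  -- Given `k` points the transform is the `k`-th power of that of one point; averaging over the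
  -- count evaluates the Poisson generating function there.
  have h1 : ∀ k : ℕ, ∫⁻ x, negExp (∑' j, if j < k then f (x j) else 0)
      ∂(Measure.infinitePi fun _ : ℕ => κ) = (∫⁻ x, negExp (f x) ∂κ) ^ k := fun k => by
    have hY : ∀ j, Measurable fun x : E => if j < k then f x else 0 := fun j => by
      by_cases hj : j < k <;> simp [hj, hf]
    rw [lintegral_negExp_tsum (iIndepFun_infinitePi (P := fun _ : ℕ => κ) hY)
      (fun j => (hY j).comp (measurable_pi_apply j))
      (a := fun j => if j < k then negLog (∫⁻ x, negExp (f x) ∂κ) else 0) fun j => ?_]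
    · rw [tsum_eq_sum (s := Finset.range k) fun j hj => if_neg (by simpa using hj), negExp_sum,
        Finset.prod_congr rfl fun j hj => by
          rw [if_pos (Finset.mem_range.1 hj), negExp_negLog hs]]
      simp
    · rw [(measurePreserving_eval_infinitePi (fun _ : ℕ => κ) j).lintegral_comp (hY j).negExp]
      by_cases hj : j < k
      · simp [hj, negExp_negLog hs]
      · simp [hj]
  rw [lintegral_prod _ hm.aemeasurable]
  simp_rw [h1]
  rw [lintegral_pow_poissonMeasure r hs, lintegral_sub hf.negExp (hs.trans_lt ENNReal.one_lt_top).ne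
    (ae_of_all _ fun x => negExp_le_one _)]
  simp

/-- The points of a Poisson process, built shell by shell: a Poisson number of i.i.d. points. -/
noncomputable def shellPoint (n j : ℕ) (z : ℕ × (ℕ → PosReal)) : ℝ :=
  if j < z.1 then (if shellIndex (z.2 j) = n then (z.2 j : ℝ) else 0) else 0

lemma measurable_shellPoint (n j : ℕ) : Measurable (shellPoint n j) := by
  refine Measurable.ite (measurableSet_lt measurable_const measurable_fst)
    (Measurable.ite ?_ (by fun_prop) measurable_const) measurable_const
  exact (measurable_shellIndex.comp ((measurable_pi_apply j).comp measurable_snd))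
    (measurableSet_singleton n)

lemma shellPoint_nonneg (n j : ℕ) (z : ℕ × (ℕ → PosReal)) : 0 ≤ shellPoint n j z := by
  unfold shellPoint
  split_ifs
  exacts [(z.2 j).2.le, le_rfl, le_rfl]

lemma zeroExtend_shellPoint (f : PosReal → ℝ≥0∞) (n j : ℕ) (z : ℕ × (ℕ → PosReal)) :
    zeroExtend f (shellPoint n j z)
      = if j < z.1 then (shellIndex ⁻¹' {n}).indicator f (z.2 j) else 0 := by
  unfold shellPoint
  split_ifs with h1 h2
  · simp [h2]
  · simp [h2]
  · simp

/-- Each shell independently receives a Poisson number of i.i.d. points drawn from normalised `ν`.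
The Laplace functionals multiply, and their exponents add up to the integral over all shells. -/
theorem exists_isPoissonPoints (ν : Measure PosReal) [IsFiniteMeasureOnCompacts ν] :
    ∃ (Ω : Type) (_ : MeasurableSpace Ω) (P : Measure Ω) (p : ℕ → Ω → ℝ),
      IsProbabilityMeasure P ∧ IsPoissonPoints ν p P := by
  have : Nonempty PosReal := ⟨⟨1, one_pos⟩⟩
  have hm : ∀ n : ℕ, MeasurableSet (shellIndex ⁻¹' {n}) := fun n =>
    measurable_shellIndex (measurableSet_singleton n)
  have hκ : ∀ n : ℕ, ∃ κ : Measure PosReal, IsProbabilityMeasure κ ∧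
      ν (shellIndex ⁻¹' {n}) • κ = ν.restrict (shellIndex ⁻¹' {n}) := fun n => by
    have : IsFiniteMeasure (ν.restrict (shellIndex ⁻¹' {n})) :=
      ⟨by simpa using measure_shell_lt_top ν n⟩
    simpa using exists_isProbabilityMeasure_smul_eq (ν.restrict (shellIndex ⁻¹' {n}))
  choose κ hκp hκ using hκ
  let μ : ℕ → Measure (ℕ × (ℕ → PosReal)) := fun n =>
    (poissonMeasure (ν (shellIndex ⁻¹' {n})).toNNReal).prod (Measure.infinitePi fun _ : ℕ => κ n)
  let p : ℕ → (ℕ → ℕ × (ℕ → PosReal)) → ℝ := fun i ω =>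
    shellPoint i.unpair.1 i.unpair.2 (ω i.unpair.1)
  have hp : ∀ i, Measurable (p i) := fun i =>
    (measurable_shellPoint _ _).comp (measurable_pi_apply _)
  refine ⟨ℕ → ℕ × (ℕ → PosReal), inferInstance, Measure.infinitePi μ, p, inferInstance, hp,
    fun i ω => shellPoint_nonneg _ _ _, isPoissonProcess_of_lintegral_negExp
      (measurable_pointMeasureOf hp) (fun ω => isPointMeasure_pointMeasureOf fun K hK => ?_)
      fun f hf => ?_⟩
  · obtain ⟨M, hM⟩ := exists_shellIndex_le hK
    have hfin : (⋃ n ∈ Set.Iic M, (fun j => Nat.pair n j) '' Set.Iio (ω n).1).Finite :=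
      (Set.finite_Iic M).biUnion fun n _ => (Set.finite_Iio _).image _
    refine hfin.subset fun i hi => ?_
    obtain ⟨x, hxK, hx⟩ := hi
    -- `shellPoint` discards samples outside their shell, so local finiteness holds for every `ω`,
    -- not just almost every one.
    simp only [p, shellPoint] at hx
    split_ifs at hx with h1 h2
    · refine Set.mem_biUnion (x := i.unpair.1) ?_ ⟨i.unpair.2, h1, Nat.pair_unpair i⟩
      rw [← h2, ← Subtype.ext hx]
      exact hM x hxK
    · exact absurd hx x.2.ne'
    · exact absurd hx x.2.ne'
  · have h1 : ∀ ω, ∫⁻ x, f x ∂(pointMeasureOf fun i => p i ω)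
        = ∑' n, ∑' j, zeroExtend f (shellPoint n j (ω n)) := fun ω => by
      rw [lintegral_pointMeasureOf _ hf, ← ENNReal.tsum_prod,
        ← Nat.pairEquiv.symm.tsum_eq (fun a : ℕ × ℕ => zeroExtend f (shellPoint a.1 a.2 (ω a.1)))]
      rfl
    simp_rw [h1]
    have hY : ∀ n, Measurable fun z => ∑' j, zeroExtend f (shellPoint n j z) := fun n =>
      Measurable.tsum fun j => (measurable_zeroExtend hf).comp (measurable_shellPoint n j)
    rw [lintegral_negExp_tsum (iIndepFun_infinitePi hY)
      (fun n => (hY n).comp (measurable_pi_apply n))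
      (a := fun n => ∫⁻ x in shellIndex ⁻¹' {n}, 1 - negExp (f x) ∂ν) fun n => ?_]
    · rw [← lintegral_iUnion hm fun i j hij => Disjoint.preimage _ (by simpa using hij)]
      congr 1
      rw [show ⋃ n, shellIndex ⁻¹' {n} = Set.univ by ext x; simp, Measure.restrict_univ]
    · rw [(measurePreserving_eval_infinitePi μ n).lintegral_comp (hY n).negExp]
      simp_rw [zeroExtend_shellPoint]
      rw [lintegral_negExp_compoundPoisson _ _ (hf.indicator (hm n)),
        ENNReal.coe_toNNReal (measure_shell_lt_top ν n).ne, ← smul_eq_mul,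
        ← lintegral_smul_measure, hκ]
      congr 1
      refine setLIntegral_congr_fun (hm n) fun x hx => ?_
      simp only [Set.indicator_of_mem hx]

/-! ### Moving the zeros to the end of the list -/

section Compress

open Classical in
/-- The list of the positive terms of a sequence, followed by zeros. -/
noncomputable def compress (p : ℕ → ℝ) (i : ℕ) : ℝ :=
  (∑' k, if 0 < p k ∧ Nat.count (fun j => 0 < p j) k = i then ENNReal.ofReal (p k) else 0).toReal

lemma compress_nonneg (p : ℕ → ℝ) (i : ℕ) : 0 ≤ compress p i := ENNReal.toReal_nonneg

-- Distinct positive terms have distinct ranks, so the series defining `compress` has a single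
-- nonzero term here.
open Classical in
lemma compress_count {p : ℕ → ℝ} {k : ℕ} (hk : 0 < p k) :
    compress p (Nat.count (fun j => 0 < p j) k) = p k := by
  rw [compress, tsum_eq_single k fun l hl => if_neg fun h => hl (Nat.count_injective h.1 hk h.2)]
  simp [hk, hk.le]

open Classical in
lemma exists_of_compress_ne_zero {p : ℕ → ℝ} {i : ℕ} (h : compress p i ≠ 0) :
    ∃ k, 0 < p k ∧ Nat.count (fun j => 0 < p j) k = i := by
  by_contra! hk
  refine h ?_
  rw [compress, ENNReal.tsum_eq_zero.2 fun k => if_neg fun hk' => hk k hk'.1 hk'.2,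
    ENNReal.toReal_zero]

/-- The rank map matches the nonzero terms of the two series bijectively; zeros contribute nothing
since `g 0 = 0`. -/
lemma tsum_compress (p : ℕ → ℝ) (hp : ∀ i, 0 ≤ p i) {g : ℝ → ℝ≥0∞} (hg : g 0 = 0) :
    ∑' i, g (compress p i) = ∑' i, g (p i) := by
  classical
  have hpos : ∀ k : Function.support fun k => g (p k), 0 < p k := fun k =>
    (hp k).lt_of_ne fun h0 => k.2 (by simp [← h0, hg])
  refine tsum_eq_tsum_of_ne_zero_bij (g := fun k => g (p k))
    (fun k => Nat.count (fun j => 0 < p j) k)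
    (fun k l hkl => Subtype.ext (Nat.count_injective (hpos k) (hpos l) hkl)) ?_ fun k => ?_
  · intro i hi
    obtain ⟨k, hk, rfl⟩ := exists_of_compress_ne_zero (p := p) (i := i)
      fun h0 => hi (by simp [h0, hg])
    exact ⟨⟨k, by simpa [compress_count hk] using hi⟩, rfl⟩
  · simp only [compress_count (hpos k)]

/-- A point in slot `i + 1` has more than `i` positive terms before it, and the one of rank `i`
would fill slot `i`. -/
lemma compress_succ_eq_zero {p : ℕ → ℝ} {i : ℕ} (h : compress p i = 0) :
    compress p (i + 1) = 0 := by
  classical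
  by_contra h0
  obtain ⟨k, hk, hki⟩ := exists_of_compress_ne_zero h0
  have hlt : i < Nat.count (fun j => 0 < p j) k := by omega
  have hmem : 0 < p (Nat.nth (fun j => 0 < p j) i) :=
    Nat.nth_mem i fun hf => hlt.trans_le (Nat.count_le_card hf k)
  have hcount : Nat.count (fun j => 0 < p j) (Nat.nth (fun j => 0 < p j) i) = i :=
    Nat.count_nth fun hf => hlt.trans_le (Nat.count_le_card hf k)
  have := compress_count hmem
  rw [hcount, h] at this
  exact hmem.ne this

lemma measurable_compress {Ω : Type*} [MeasurableSpace Ω] {p : ℕ → Ω → ℝ}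
    (hp : ∀ i, Measurable (p i)) (i : ℕ) : Measurable fun ω => compress (fun k => p k ω) i := by
  classical
  have hpos : ∀ k, MeasurableSet {ω | 0 < p k ω} := fun k => measurableSet_lt measurable_const (hp k)
  have hcount : ∀ k, Measurable fun ω => Nat.count (fun j => 0 < p j ω) k := fun k => by
    simp_rw [Nat.count_eq_card_filter_range, Finset.card_filter]
    exact Finset.measurable_sum _ fun j _ =>
      Measurable.ite (hpos j) measurable_const measurable_const
  unfold compress
  refine (Measurable.tsum fun k => Measurable.ite ?_ (hp k).ennreal_ofReal
    measurable_const).ennreal_toReal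
  exact (hpos k).inter (hcount k (measurableSet_singleton i))

lemma IsPoissonPoints.compress {Ω : Type*} [MeasurableSpace Ω] {ν : Measure PosReal}
    {p : ℕ → Ω → ℝ} {P : Measure Ω} (h : IsPoissonPoints ν p P) :
    IsPoissonPoints ν (fun i ω => compress (fun k => p k ω) i) P := by
  refine ⟨measurable_compress h.measurable, fun i ω => compress_nonneg _ _, ?_⟩
  have : (fun ω => pointMeasureOf fun i => _root_.compress (fun k => p k ω) i)
      = fun ω => pointMeasureOf fun i => p i ω := funext fun ω =>
    pointMeasureOf_congr fun g hg => tsum_compress _ (fun i => h.nonneg i ω) hg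
  rw [this]
  exact IsPoissonPoints.isPoissonProcess h

end Compress

/-! ### Adjoining independent marks -/

/-- The Laplace functional depends only on the law of the process, so the Poisson property lifts to
the product space carrying the marks. -/
lemma IsPoissonPoints.comp_measurePreserving {Ω Ω' : Type*} [MeasurableSpace Ω]
    [MeasurableSpace Ω'] {ν : Measure PosReal} [SigmaFinite ν] {p : ℕ → Ω → ℝ} {P : Measure Ω}
    [IsProbabilityMeasure P] {P' : Measure Ω'} [IsProbabilityMeasure P']
    (h : IsPoissonPoints ν p P) {φ : Ω' → Ω} (hφ : MeasurePreserving φ P' P) :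
    IsPoissonPoints ν (fun i ω => p i (φ ω)) P' := by
  have hN := IsPoissonPoints.isPoissonProcess h
  refine ⟨fun i => (h.measurable i).comp hφ.measurable, fun i ω => h.nonneg i _,
    isPoissonProcess_of_lintegral_negExp (hN.measurable.comp hφ.measurable)
      (fun ω => hN.isPointMeasure _) fun f hf => ?_⟩
  rw [← hN.lintegral_negExp_lintegral hf]
  exact hφ.lintegral_comp ((Measure.measurable_lintegral hf).comp hN.measurable).negExp

theorem exists_isMarkedPoissonPoints (ν F : Measure PosReal) [IsFiniteMeasureOnCompacts ν]
    [IsProbabilityMeasure F] :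
    ∃ (Ω : Type) (_ : MeasurableSpace Ω) (P : Measure Ω) (p : ℕ → Ω → ℝ) (W : ℕ → Ω → PosReal),
      IsProbabilityMeasure P ∧ IsMarkedPoissonPoints ν F p W P ∧
        ∀ i ω, p i ω = 0 → p (i + 1) ω = 0 := by
  obtain ⟨Ω, _, P, p, hP, hp⟩ := exists_isPoissonPoints ν
  have hpts := hp.compress.comp_measurePreserving
    (measurePreserving_fst (μ := P) (ν := Measure.infinitePi fun _ : ℕ => F))
  have hmp : MeasurePreserving (Prod.snd : Ω × (ℕ → PosReal) → _)
    (P.prod (Measure.infinitePi fun _ : ℕ => F)) (Measure.infinitePi fun _ : ℕ => F) :=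
    measurePreserving_snd
  have hi : iIndepFun (fun i (ω : ℕ → PosReal) => ω i) (Measure.infinitePi fun _ : ℕ => F) :=
    iIndepFun_infinitePi (X := fun _ x => x) fun _ => measurable_id
  have hlaw : ∀ i, (P.prod (Measure.infinitePi fun _ : ℕ => F)).map (fun ω => ω.2 i) = F :=
    fun i => ((measurePreserving_eval_infinitePi (fun _ : ℕ => F) i).comp hmp).map_eq
  refine ⟨Ω × (ℕ → PosReal), inferInstance, P.prod (Measure.infinitePi fun _ : ℕ => F),
    fun i ω => compress (fun k => p k ω.1) i, fun i ω => ω.2 i, inferInstance,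
    ⟨hpts, fun i => by fun_prop, hlaw, ?_, ?_⟩, fun i ω => compress_succ_eq_zero⟩
  · rw [iIndepFun_iff_map_fun_eq_infinitePi_map (by fun_prop)]
    simp_rw [hlaw]
    exact hmp.map_eq
  · exact indepFun_prod (X := fun ω i => compress (fun k => p k ω) i)
      (Y := fun (ω : ℕ → PosReal) i => ω i)
      (measurable_pi_lambda _ hp.compress.measurable) measurable_id

/-! ### The measure `ρ` as a multiplicative mixture -/

section Mixture

variable {ν F ρ : Measure PosReal} [IsProbabilityMeasure F]

lemma measurable_posReal_mul : Measurable fun z : PosReal × PosReal => z.2 * z.1 :=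
  Measurable.subtype_mk (by fun_prop)

lemma eq_map_prod
    (hρ : ∀ A : Set PosReal, MeasurableSet A →
      ρ A = ∫⁻ y, ∫⁻ w, A.indicator (fun _ => (1 : ℝ≥0∞)) (w * y) ∂F ∂ν) :
    ρ = (ν.prod F).map fun z => z.2 * z.1 := by
  ext A hA
  have hm : Measurable fun z : PosReal × PosReal =>
      A.indicator (fun _ => (1 : ℝ≥0∞)) (z.2 * z.1) :=
    (measurable_const.indicator hA).comp measurable_posReal_mul
  rw [hρ A hA, ← lintegral_prod _ hm.aemeasurable,
    ← lintegral_map (measurable_const.indicator hA) measurable_posReal_mul,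
    lintegral_indicator_const hA, one_mul]

lemma lintegral_mixture
    (hρ : ∀ A : Set PosReal, MeasurableSet A →
      ρ A = ∫⁻ y, ∫⁻ w, A.indicator (fun _ => (1 : ℝ≥0∞)) (w * y) ∂F ∂ν)
    {f : PosReal → ℝ≥0∞} (hf : Measurable f) :
    ∫⁻ x, f x ∂ρ = ∫⁻ y, ∫⁻ w, f (w * y) ∂F ∂ν := by
  have hm : Measurable fun z : PosReal × PosReal => f (z.2 * z.1) :=
    hf.comp measurable_posReal_mul
  rw [eq_map_prod hρ, lintegral_map hf measurable_posReal_mul, lintegral_prod _ hm.aemeasurable]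

end Mixture

/-! ### Laplace transform and almost sure finiteness of the series -/

section Marked

variable {Ω : Type*} [MeasurableSpace Ω] {ν F ρ : Measure PosReal} [SigmaFinite ν]
  [IsProbabilityMeasure F] {p : ℕ → Ω → ℝ} {W : ℕ → Ω → PosReal} {P : Measure Ω}
  [IsProbabilityMeasure P]

/-- The Laplace transform of the shot noise series. -/
theorem IsMarkedPoissonPoints.lintegral_negExp (h : IsMarkedPoissonPoints ν F p W P)
    (hρ : ∀ A : Set PosReal, MeasurableSet A →
      ρ A = ∫⁻ y, ∫⁻ w, A.indicator (fun _ => (1 : ℝ≥0∞)) (w * y) ∂F ∂ν) (t : ℝ≥0∞) :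
    ∫⁻ ω, negExp (t * ∑' i, ENNReal.ofReal (p i ω * W i ω)) ∂P
      = negExp (∫⁻ x, 1 - negExp (t * ENNReal.ofReal x) ∂ρ) := by
  -- `φ y` is the transform of one mark scaled by `y`. With `f = -log φ`, the conditional transform
  -- given the points is `negExp` of ∫ f dN, and `1 - negExp f = 1 - φ`.
  let φ : ℝ → ℝ≥0∞ := fun y => ∫⁻ w : PosReal, negExp (t * ENNReal.ofReal (y * w)) ∂F
  have hφ1 : ∀ y, φ y ≤ 1 := fun y => lintegral_negExp_le_one _ _
  have hφm : Measurable fun y : PosReal => φ y := by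
    have : Measurable fun z : PosReal × PosReal =>
      _root_.negExp (t * ENNReal.ofReal ((z.1 : ℝ) * z.2)) := by fun_prop
    exact this.lintegral_prod_right'
  let f : PosReal → ℝ≥0∞ := fun y => negLog (φ y)
  have hf : Measurable f := measurable_negLog.comp hφm
  have hmW : Measurable fun ω i => W i ω := measurable_pi_lambda _ h.measurable
  have hmp : Measurable fun ω i => p i ω := measurable_pi_lambda _ h.points.measurable
  have hlawW : P.map (fun ω i => W i ω) = Measure.infinitePi fun _ : ℕ => F := by
    rw [(iIndepFun_iff_map_fun_eq_infinitePi_map h.measurable).1 h.iIndep]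
    simp_rw [h.law]
  have hjoint : P.map (fun ω => (fun i => p i ω, fun i => W i ω))
      = (P.map fun ω i => p i ω).prod (Measure.infinitePi fun _ : ℕ => F) := by
    rw [← hlawW]
    exact (indepFun_iff_map_prod_eq_prod_map_map hmp.aemeasurable hmW.aemeasurable).1 h.indep
  have hm : Measurable fun z : (ℕ → ℝ) × (ℕ → PosReal) =>
      _root_.negExp (∑' i, t * ENNReal.ofReal (z.1 i * z.2 i)) := by
    refine Measurable.negExp (Measurable.tsum fun i => ?_)
    fun_prop
  have hcond : ∀ y : ℕ → ℝ, (∀ i, 0 ≤ y i) →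
      ∫⁻ w, _root_.negExp (∑' i, t * ENNReal.ofReal (y i * w i))
          ∂(Measure.infinitePi fun _ : ℕ => F)
        = _root_.negExp (∫⁻ x, f x ∂(pointMeasureOf y)) := fun y hy => by
    have hY : ∀ i, Measurable fun w : PosReal => t * ENNReal.ofReal (y i * w) := fun i => by
      fun_prop
    rw [lintegral_pointMeasureOf y hf, lintegral_negExp_tsum
      (iIndepFun_infinitePi (P := fun _ : ℕ => F) hY) fun i => (hY i).comp (measurable_pi_apply i)]
    intro i
    rw [(measurePreserving_eval_infinitePi (fun _ : ℕ => F) i).lintegral_comp (hY i).negExp]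
    -- A padding zero contributes the factor 1, in agreement with `zeroExtend f 0 = 0`.
    rcases (hy i).eq_or_lt with h0 | h0
    · simp [← h0]
    · rw [zeroExtend, dif_pos h0, negExp_negLog (hφ1 _)]
  simp_rw [← ENNReal.tsum_mul_left]
  rw [← lintegral_map (f := fun z : (ℕ → ℝ) × (ℕ → PosReal) =>
    _root_.negExp (∑' i, t * ENNReal.ofReal (z.1 i * z.2 i))) hm (hmp.prodMk hmW), hjoint,
    lintegral_prod _ hm.aemeasurable, lintegral_map hm.lintegral_prod_right' hmp]
  simp_rw [fun ω => hcond (fun i => p i ω) fun i => h.points.nonneg i ω]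
  have hN := IsPoissonPoints.isPoissonProcess h.points
  rw [hN.lintegral_negExp_lintegral hf, lintegral_mixture hρ (by fun_prop)]
  congr 1
  refine lintegral_congr fun y => ?_
  rw [negExp_negLog (hφ1 _), lintegral_sub (by fun_prop)
    ((lintegral_negExp_le_one _ _).trans_lt ENNReal.one_lt_top).ne
    (ae_of_all _ fun x => negExp_le_one _)]
  simp [φ, mul_comm]

lemma one_sub_negExp_le_min (x : ℝ≥0∞) : 1 - negExp x ≤ min 1 x := by
  refine le_min tsub_le_self ?_
  rcases eq_or_ne x ∞ with rfl | hx
  · simp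
  · rw [negExp_eq_of_ne_top hx, tsub_le_iff_right]
    nth_rw 1 [← ENNReal.ofReal_toReal hx]
    rw [← ENNReal.ofReal_add ENNReal.toReal_nonneg (Real.exp_nonneg _), ENNReal.one_le_ofReal]
    linarith [Real.add_one_le_exp (-x.toReal)]

lemma lintegral_min_one_lt_top (hLevy : IsLevyMeasure ρ)
    (hsmall : (∫⁻ x in {x : PosReal | (x : ℝ) ≤ 1}, ENNReal.ofReal (x : ℝ) ∂ρ) < ∞) :
    ∫⁻ x : PosReal, min 1 (ENNReal.ofReal x) ∂ρ < ∞ := by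
  have hm : MeasurableSet {x : PosReal | (x : ℝ) ≤ 1} :=
    measurableSet_le measurable_subtype_coe measurable_const
  rw [← lintegral_add_compl _ hm]
  refine ENNReal.add_lt_top.2 ⟨(lintegral_mono fun x => min_le_right _ _).trans_lt hsmall,
    (lintegral_mono fun x => min_le_left _ _).trans_lt ?_⟩
  have : {x : PosReal | (x : ℝ) ≤ 1}ᶜ = {x : PosReal | 1 < (x : ℝ)} := by ext x; simp
  rw [this]
  simpa using hLevy.2

-- For t > 0, E e^{-tS} ≤ P(S < ∞) because the integrand vanishes where S = ∞. Along t = 1/(n+1) the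
-- left side tends to 1, by domination of 1 - e^{-tx} by min(1, x).
open Filter Topology in
theorem IsMarkedPoissonPoints.ae_tsum_lt_top (h : IsMarkedPoissonPoints ν F p W P)
    (hρ : ∀ A : Set PosReal, MeasurableSet A →
      ρ A = ∫⁻ y, ∫⁻ w, A.indicator (fun _ => (1 : ℝ≥0∞)) (w * y) ∂F ∂ν)
    (hmin : ∫⁻ x : PosReal, min 1 (ENNReal.ofReal x) ∂ρ < ∞) :
    ∀ᵐ ω ∂P, ∑' i, ENNReal.ofReal (p i ω * W i ω) < ∞ := by
  set S : Ω → ℝ≥0∞ := fun ω => ∑' i, ENNReal.ofReal (p i ω * W i ω) with hS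
  have hSm : Measurable S := Measurable.tsum fun i =>
    ((h.points.measurable i).mul (measurable_subtype_coe.comp (h.measurable i))).ennreal_ofReal
  have ht : Tendsto (fun n : ℕ => ((n : ℝ≥0∞) + 1)⁻¹) atTop (𝓝 0) := by
    have := (tendsto_add_atTop_iff_nat 1).2 ENNReal.tendsto_inv_nat_nhds_zero
    simpa using this
  have h1 : Tendsto (fun n : ℕ => ∫⁻ x : PosReal,
      1 - negExp (((n : ℝ≥0∞) + 1)⁻¹ * ENNReal.ofReal x) ∂ρ) atTop (𝓝 0) := by
    have := tendsto_lintegral_of_dominated_convergence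
      (F := fun (n : ℕ) (x : PosReal) => 1 - negExp (((n : ℝ≥0∞) + 1)⁻¹ * ENNReal.ofReal x))
      (f := fun _ => 0) (μ := ρ) (fun x : PosReal => min 1 (ENNReal.ofReal x))
      (fun n => by fun_prop) (fun n => ae_of_all _ fun x => ?_) hmin.ne (ae_of_all _ fun x => ?_)
    · simpa using this
    · refine (one_sub_negExp_le_min _).trans (min_le_min le_rfl ?_)
      exact mul_le_of_le_one_left' (ENNReal.inv_le_one.2 le_add_self)
    · have h2 := ENNReal.Tendsto.mul_const (b := ENNReal.ofReal x) ht (Or.inr ENNReal.ofReal_ne_top)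
      rw [zero_mul] at h2
      simpa using ENNReal.Tendsto.sub (tendsto_const_nhds (x := (1 : ℝ≥0∞)))
        ((continuous_negExp.tendsto _).comp h2) (Or.inl ENNReal.one_ne_top)
  have h2 : ∀ n : ℕ, negExp (∫⁻ x : PosReal,
      1 - negExp (((n : ℝ≥0∞) + 1)⁻¹ * ENNReal.ofReal x) ∂ρ) ≤ P {ω | S ω < ∞} := fun n => by
    rw [← h.lintegral_negExp hρ,
      ← lintegral_indicator_one (s := {ω | S ω < ∞}) (hSm measurableSet_Iio)]
    refine lintegral_mono fun ω => ?_
    by_cases hω : S ω < ∞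
    · rw [Set.indicator_of_mem (by exact hω)]
      exact negExp_le_one _
    · have : S ω = ∞ := by simpa using hω
      change negExp (_ * S ω) ≤ _
      rw [this, ENNReal.mul_top (by simp)]
      simp
  have h3 : 1 ≤ P {ω | S ω < ∞} := by
    simpa using le_of_tendsto ((continuous_negExp.tendsto _).comp h1) (Eventually.of_forall h2)
  exact (mem_ae_iff_prob_eq_one (hSm measurableSet_Iio)).2 (le_antisymm prob_le_one h3)

end Marked

/-! ### Analytic continuation to the imaginary axis -/

section Continuation

variable {α : Type*} [MeasurableSpace α] {μ : Measure α} {X : α → ℝ}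

lemma norm_cexp_mul_sub_one_le {z : ℂ} (hz : z.re ≤ 0) {x : ℝ} (hx : 0 ≤ x) :
    ‖Complex.exp (z * x) - 1‖ ≤ (2 + 2 * ‖z‖) * min 1 x := by
  have h1 : ‖Complex.exp (z * x)‖ ≤ 1 := by
    rw [Complex.norm_exp]
    simpa using mul_nonpos_of_nonpos_of_nonneg hz hx
  have h2 : ‖Complex.exp (z * x) - 1‖ ≤ 2 :=
    (norm_sub_le _ _).trans (by rw [norm_one]; linarith)
  have h3 : ‖z * x‖ = ‖z‖ * x := by rw [norm_mul, Complex.norm_real, Real.norm_of_nonneg hx]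
  have h4 : ‖Complex.exp (z * x) - 1‖ ≤ 2 * (‖z‖ * x) := by
    rcases le_total ‖z * x‖ 1 with h | h
    · exact (Complex.norm_exp_sub_one_le h).trans_eq (by rw [h3])
    · rw [h3] at h
      linarith
  rcases le_total 1 x with h | h
  · rw [min_eq_left h]
    linarith [norm_nonneg z]
  · rw [min_eq_right h]
    nlinarith

lemma integrable_cexp_mul_sub_one (hX : AEStronglyMeasurable X μ) (h0 : ∀ a, 0 ≤ X a)
    (hint : Integrable (fun a => min 1 (X a)) μ) {z : ℂ} (hz : z.re ≤ 0) :
    Integrable (fun a => Complex.exp (z * X a) - 1) μ := by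
  refine (hint.const_mul (2 + 2 * ‖z‖)).mono' ?_
    (ae_of_all _ fun a => norm_cexp_mul_sub_one_le hz (h0 a))
  have := hX.aemeasurable
  exact AEMeasurable.aestronglyMeasurable (by fun_prop)

/-- Since δx e^{-δx} ≤ 1, the z-derivative of e^{zx} is dominated by min(1, x) uniformly on Re z ≤
-δ, which permits differentiation under the integral. -/
lemma norm_mul_cexp_le {z : ℂ} {δ : ℝ} (hδ : 0 < δ) (hz : z.re ≤ -δ) {x : ℝ} (hx : 0 ≤ x) :
    ‖(x : ℂ) * Complex.exp (z * x)‖ ≤ (1 + δ⁻¹) * min 1 x := by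
  rw [norm_mul, Complex.norm_real, Real.norm_of_nonneg hx, Complex.norm_exp]
  have h1 : (z * x).re ≤ -(δ * x) := by
    simp only [Complex.mul_re, Complex.ofReal_re, Complex.ofReal_im, mul_zero, sub_zero]
    nlinarith
  have h2 : Real.exp (z * x).re ≤ 1 := Real.exp_le_one_iff.2 (h1.trans (by
    have := mul_nonneg hδ.le hx
    linarith))
  have h3 : δ * x * Real.exp (z * x).re ≤ 1 := by
    have h4 : δ * x ≤ Real.exp (δ * x) := by linarith [Real.add_one_le_exp (δ * x)]
    calc δ * x * Real.exp (z * x).re ≤ Real.exp (δ * x) * Real.exp (-(δ * x)) := by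
          gcongr
      _ = 1 := by rw [← Real.exp_add]; simp
  have hδ' : 0 < δ⁻¹ := inv_pos.2 hδ
  rcases le_total 1 x with h | h
  · rw [min_eq_left h, mul_one]
    have : x * Real.exp (z * x).re = δ⁻¹ * (δ * x * Real.exp (z * x).re) := by
      field_simp
    rw [this]
    nlinarith
  · rw [min_eq_right h]
    nlinarith [mul_le_mul_of_nonneg_left h2 hx, mul_nonneg hδ'.le hx]

lemma differentiableOn_integral_cexp_mul_sub_one (hX : Measurable X) (h0 : ∀ a, 0 ≤ X a)
    (hint : Integrable (fun a => min 1 (X a)) μ) :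
    DifferentiableOn ℂ (fun z : ℂ => ∫ a, (Complex.exp (z * X a) - 1) ∂μ) {z | z.re < 0} := by
  intro z hz
  have hz' : z.re < 0 := hz
  -- Half the distance from `z` to the imaginary axis: the half-plane Re w < -δ is a neighbourhood
  -- of `z` with a uniform bound.
  have hδ : 0 < -z.re / 2 := by linarith
  refine DifferentiableAt.differentiableWithinAt (HasDerivAt.differentiableAt
    (hasDerivAt_integral_of_dominated_loc_of_deriv_le (s := {w : ℂ | w.re < z.re / 2})
      (bound := fun a => (1 + (-z.re / 2)⁻¹) * min 1 (X a))
      (F' := fun w a => X a * Complex.exp (w * X a))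
      ((isOpen_lt Complex.continuous_re continuous_const).mem_nhds
        (show z.re < z.re / 2 by linarith))
      (Filter.Eventually.of_forall fun w => Measurable.aestronglyMeasurable (by fun_prop))
      (integrable_cexp_mul_sub_one hX.aestronglyMeasurable h0 hint hz'.le)
      (Measurable.aestronglyMeasurable (by fun_prop))
      (ae_of_all _ fun a w hw => norm_mul_cexp_le hδ (by
        have : w.re < z.re / 2 := hw
        linarith) (h0 a)) (hint.const_mul _) (ae_of_all _ fun a w _ => ?_)).2)
  have := (((hasDerivAt_id w).mul_const (X a : ℂ)).cexp).sub_const 1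
  simpa [mul_comm] using this

open Filter Topology in
lemma tendsto_integral_cexp_mul_sub_one (hX : Measurable X) (h0 : ∀ a, 0 ≤ X a)
    (hint : Integrable (fun a => min 1 (X a)) μ) (u : ℝ) :
    Tendsto (fun n : ℕ => ∫ a, (Complex.exp ((Complex.I * u - 1 / ((n : ℂ) + 1)) * X a) - 1) ∂μ)
      atTop (𝓝 (∫ a, (Complex.exp (Complex.I * u * X a) - 1) ∂μ)) := by
  have hre : ∀ n : ℕ, (1 / ((n : ℂ) + 1)) = ((1 / ((n : ℝ) + 1) : ℝ) : ℂ) := fun n => by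
    push_cast; rfl
  refine tendsto_integral_of_dominated_convergence (fun a => (2 + 2 * (|u| + 1)) * min 1 (X a))
    (fun n => Measurable.aestronglyMeasurable (by fun_prop)) (hint.const_mul _)
    (fun n => ae_of_all _ fun a => ?_) (ae_of_all _ fun a => ?_)
  · have hpos : 0 ≤ 1 / ((n : ℝ) + 1) := by positivity
    have hle : 1 / ((n : ℝ) + 1) ≤ 1 := (div_le_one (by positivity)).2 (by simp)
    refine (norm_cexp_mul_sub_one_le ?_ (h0 a)).trans ?_
    · rw [hre]
      simp only [Complex.sub_re, Complex.mul_re, Complex.I_re, Complex.I_im, Complex.ofReal_re,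
        Complex.ofReal_im]
      linarith
    · have : ‖Complex.I * u - 1 / ((n : ℂ) + 1)‖ ≤ |u| + 1 := by
        refine (norm_sub_le _ _).trans (add_le_add ?_ ?_)
        · simp
        · rw [hre, Complex.norm_real, Real.norm_of_nonneg hpos]
          exact hle
      have hm : 0 ≤ min 1 (X a) := le_min zero_le_one (h0 a)
      gcongr
  · have h1 : Tendsto (fun n : ℕ => Complex.I * u - 1 / ((n : ℂ) + 1)) atTop
        (𝓝 (Complex.I * u - 0)) :=
      tendsto_const_nhds.sub tendsto_one_div_add_atTop_nhds_zero_nat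
    rw [sub_zero] at h1
    exact ((Complex.continuous_exp.tendsto _).comp (h1.mul_const _)).sub_const 1

open Filter Topology in
/-- An exponential relation between Laplace transforms on `(-∞, 0)` extends to the imaginary
axis. -/
theorem one_add_integral_cexp_eq {β : Type*} [MeasurableSpace β] {ρ : Measure β} {Y : β → ℝ}
    (hX : Measurable X) (hX0 : ∀ a, 0 ≤ X a) (hXint : Integrable (fun a => min 1 (X a)) μ)
    (hY : Measurable Y) (hY0 : ∀ a, 0 ≤ Y a) (hYint : Integrable (fun a => min 1 (Y a)) ρ)
    (h : ∀ t : ℝ, 0 < t → 1 + ∫ a, (Real.exp (-t * X a) - 1) ∂μ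
      = Real.exp (∫ b, (Real.exp (-t * Y b) - 1) ∂ρ)) (u : ℝ) :
    1 + ∫ a, (Complex.exp (Complex.I * u * X a) - 1) ∂μ
      = Complex.exp (∫ b, (Complex.exp (Complex.I * u * Y b) - 1) ∂ρ) := by
  have hU : IsOpen {z : ℂ | z.re < 0} := isOpen_lt Complex.continuous_re continuous_const
  -- Subtracting 1 inside the integral lets the same lemmas serve a probability measure and a
  -- possibly infinite `ρ`.
  have hf : AnalyticOnNhd ℂ (fun z : ℂ => 1 + ∫ a, (Complex.exp (z * X a) - 1) ∂μ)
      {z | z.re < 0} :=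
    DifferentiableOn.analyticOnNhd
      ((differentiableOn_integral_cexp_mul_sub_one hX hX0 hXint).const_add 1) hU
  have hg : AnalyticOnNhd ℂ (fun z : ℂ => Complex.exp (∫ b, (Complex.exp (z * Y b) - 1) ∂ρ))
      {z | z.re < 0} :=
    DifferentiableOn.analyticOnNhd
      (differentiableOn_integral_cexp_mul_sub_one hY hY0 hYint).cexp hU
  have hreal : ∀ t : ℝ, 0 < t → 1 + ∫ a, (Complex.exp (((-t : ℝ) : ℂ) * X a) - 1) ∂μ
      = Complex.exp (∫ b, (Complex.exp (((-t : ℝ) : ℂ) * Y b) - 1) ∂ρ) := fun t ht => by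
    have := congrArg (fun r : ℝ => (r : ℂ)) (h t ht)
    simp only [Complex.ofReal_add, Complex.ofReal_exp, ← integral_complex_ofReal] at this
    simpa using this
  -- Real points other than -1 accumulating at -1, inside the half-plane, for the identity theorem.
  have hseq : Tendsto (fun n : ℕ => ((-(1 + 1 / ((n : ℝ) + 1)) : ℝ) : ℂ)) atTop
      (𝓝[≠] (-1 : ℂ)) := by
    refine tendsto_nhdsWithin_iff.2 ⟨?_, Eventually.of_forall fun n h' => ?_⟩
    · have := ((tendsto_one_div_add_atTop_nhds_zero_nat (𝕜 := ℝ)).const_add 1).neg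
      have h' := (Complex.continuous_ofReal.tendsto _).comp this
      rwa [show ((-(1 + 0) : ℝ) : ℂ) = -1 by simp] at h'
    · have h1 : (-(1 + 1 / ((n : ℝ) + 1)) : ℝ) = -1 :=
        Complex.ofReal_injective (Eq.trans h' (by simp))
      have h2 : 0 < 1 / ((n : ℝ) + 1) := by positivity
      linarith
  have heq := hf.eqOn_of_preconnected_of_frequently_eq hg
    (convex_halfSpace_re_lt 0).isPreconnected (show (-1 : ℂ) ∈ {z : ℂ | z.re < 0} by simp)
    (hseq.frequently (Frequently.of_forall fun n => hreal _ (by positivity)))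
  refine tendsto_nhds_unique ((tendsto_integral_cexp_mul_sub_one hX hX0 hXint u).const_add 1) ?_
  refine ((Complex.continuous_exp.tendsto _).comp
    (tendsto_integral_cexp_mul_sub_one hY hY0 hYint u)).congr fun n => (heq ?_).symm
  have hre : (1 / ((n : ℂ) + 1)) = ((1 / ((n : ℝ) + 1) : ℝ) : ℂ) := by push_cast; rfl
  have hpos : 0 < 1 / ((n : ℝ) + 1) := by positivity
  simp only [Set.mem_ofPred_eq, hre, Complex.sub_re, Complex.mul_re, Complex.I_re, Complex.I_im,
    Complex.ofReal_re, Complex.ofReal_im]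
  linarith

end Continuation

/-! ### The real-valued series and its characteristic function -/

section Series

variable {Ω : Type*} [MeasurableSpace Ω] {ν F ρ : Measure PosReal} {p : ℕ → Ω → ℝ}
  {W : ℕ → Ω → PosReal} {P : Measure Ω}

lemma IsMarkedPoissonPoints.mul_nonneg (h : IsMarkedPoissonPoints ν F p W P) (i : ℕ) (ω : Ω) :
    0 ≤ p i ω * (W i ω : ℝ) := _root_.mul_nonneg (h.points.nonneg i ω) (W i ω).2.le

/-- This holds also where the series diverges: both sides then take the default value 0. -/
lemma IsMarkedPoissonPoints.tsum_eq_toReal (h : IsMarkedPoissonPoints ν F p W P) (ω : Ω) :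
    ∑' i, p i ω * (W i ω : ℝ) = (∑' i, ENNReal.ofReal (p i ω * W i ω)).toReal := by
  rw [ENNReal.tsum_toReal_eq fun i => ENNReal.ofReal_ne_top]
  exact tsum_congr fun i => (ENNReal.toReal_ofReal (h.mul_nonneg i ω)).symm

lemma IsMarkedPoissonPoints.measurable_tsum (h : IsMarkedPoissonPoints ν F p W P) :
    Measurable fun ω => ∑' i, p i ω * (W i ω : ℝ) := by
  simp_rw [h.tsum_eq_toReal]
  exact (Measurable.tsum fun i => ((h.points.measurable i).mul
    (measurable_subtype_coe.comp (h.measurable i))).ennreal_ofReal).ennreal_toReal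

lemma integrable_min_one
    (hmin : ∫⁻ x : PosReal, min 1 (ENNReal.ofReal x) ∂ρ < ∞) :
    Integrable (fun x : PosReal => min 1 (x : ℝ)) ρ := by
  refine ⟨by fun_prop, ?_⟩
  rw [hasFiniteIntegral_iff_ofReal (ae_of_all _ fun x => le_min zero_le_one x.2.le)]
  simpa [ENNReal.ofReal_min] using hmin

variable [SigmaFinite ν] [IsProbabilityMeasure F] [IsProbabilityMeasure P]

lemma IsMarkedPoissonPoints.ae_summable (h : IsMarkedPoissonPoints ν F p W P)
    (hρ : ∀ A : Set PosReal, MeasurableSet A →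
      ρ A = ∫⁻ y, ∫⁻ w, A.indicator (fun _ => (1 : ℝ≥0∞)) (w * y) ∂F ∂ν)
    (hmin : ∫⁻ x : PosReal, min 1 (ENNReal.ofReal x) ∂ρ < ∞) :
    ∀ᵐ ω ∂P, Summable fun i => p i ω * (W i ω : ℝ) := by
  filter_upwards [h.ae_tsum_lt_top hρ hmin] with ω hω
  refine (ENNReal.summable_toReal hω.ne).congr fun i => ?_
  exact ENNReal.toReal_ofReal (h.mul_nonneg i ω)

lemma IsMarkedPoissonPoints.integral_exp_neg (h : IsMarkedPoissonPoints ν F p W P)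
    (hρ : ∀ A : Set PosReal, MeasurableSet A →
      ρ A = ∫⁻ y, ∫⁻ w, A.indicator (fun _ => (1 : ℝ≥0∞)) (w * y) ∂F ∂ν)
    (hmin : ∫⁻ x : PosReal, min 1 (ENNReal.ofReal x) ∂ρ < ∞) {t : ℝ} (ht : 0 < t) :
    ∫ ω, Real.exp (-t * ∑' i, p i ω * (W i ω : ℝ)) ∂P
      = Real.exp (∫ x : PosReal, (Real.exp (-t * x) - 1) ∂ρ) := by
  have hS := h.measurable_tsum
  have h1 : ∫⁻ ω, ENNReal.ofReal (Real.exp (-t * ∑' i, p i ω * (W i ω : ℝ))) ∂P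
      = ∫⁻ ω, negExp (ENNReal.ofReal t * ∑' i, ENNReal.ofReal (p i ω * W i ω)) ∂P := by
    -- Where the series diverges the integrands differ (1 on the left by the default sum 0, and 0 on
    -- the right), so almost sure finiteness is essential.
    refine lintegral_congr_ae ?_
    filter_upwards [h.ae_tsum_lt_top hρ hmin] with ω hω
    rw [negExp_eq_of_ne_top (ENNReal.mul_ne_top ENNReal.ofReal_ne_top hω.ne), ENNReal.toReal_mul,
      ENNReal.toReal_ofReal ht.le, h.tsum_eq_toReal, neg_mul]
  have h2 : ∀ x : PosReal, 1 - negExp (ENNReal.ofReal t * ENNReal.ofReal x)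
      = ENNReal.ofReal (1 - Real.exp (-t * x)) := fun x => by
    rw [← ENNReal.ofReal_mul ht.le, negExp_ofReal (_root_.mul_nonneg ht.le x.2.le),
      ENNReal.ofReal_sub _ (Real.exp_nonneg _), ENNReal.ofReal_one, neg_mul]
  have hint : Integrable (fun x : PosReal => 1 - Real.exp (-t * x)) ρ := by
    have := (integrable_cexp_mul_sub_one (X := fun x : PosReal => (x : ℝ)) (z := ((-t : ℝ) : ℂ))
      measurable_subtype_coe.aestronglyMeasurable (fun x => x.2.le) (integrable_min_one hmin)
      (by simpa using ht.le)).re.neg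
    refine this.congr (ae_of_all _ fun x => ?_)
    have h3 : Complex.exp (((-t : ℝ) : ℂ) * ((x : ℝ) : ℂ)) - 1
        = ((Real.exp (-t * x) - 1 : ℝ) : ℂ) := by push_cast; rfl
    simp only [Pi.neg_apply, h3]
    change -(Real.exp (-t * x) - 1) = _
    ring
  have hnn : ∀ x : PosReal, 0 ≤ 1 - Real.exp (-t * x) := fun x =>
    sub_nonneg.2 (Real.exp_le_one_iff.2 (by nlinarith [mul_pos ht x.2]))
  rw [integral_eq_lintegral_of_nonneg_ae (ae_of_all _ fun ω => (Real.exp_nonneg _))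
    (Measurable.aestronglyMeasurable (by fun_prop)), h1, h.lintegral_negExp hρ]
  simp_rw [h2]
  rw [← ofReal_integral_eq_lintegral_ofReal hint (ae_of_all _ hnn),
    negExp_ofReal (integral_nonneg hnn), ENNReal.toReal_ofReal (Real.exp_nonneg _),
    ← integral_neg]
  simp_rw [neg_sub]

/-- The characteristic function of the shot noise series. -/
theorem IsMarkedPoissonPoints.hasLevyCharFun (h : IsMarkedPoissonPoints ν F p W P)
    (hρ : ∀ A : Set PosReal, MeasurableSet A →
      ρ A = ∫⁻ y, ∫⁻ w, A.indicator (fun _ => (1 : ℝ≥0∞)) (w * y) ∂F ∂ν)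
    (hmin : ∫⁻ x : PosReal, min 1 (ENNReal.ofReal x) ∂ρ < ∞) :
    HasLevyCharFun ρ (fun ω => ∑' i, p i ω * (W i ω : ℝ)) P := by
  intro u
  have hS := h.measurable_tsum
  have hS0 : ∀ ω, 0 ≤ ∑' i, p i ω * (W i ω : ℝ) := fun ω => tsum_nonneg fun i => h.mul_nonneg i ω
  rw [← one_add_integral_cexp_eq (μ := P) hS hS0 ?_ measurable_subtype_coe (fun x : PosReal => x.2.le)
    (integrable_min_one hmin) (fun t ht => ?_) u]
  · rw [integral_sub ?_ (integrable_const _)]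
    · simp
    · refine (integrable_const (1 : ℝ)).mono' (Measurable.aestronglyMeasurable (by fun_prop))
        (ae_of_all _ fun ω => ?_)
      rw [mul_assoc, ← Complex.ofReal_mul, mul_comm, Complex.norm_exp_ofReal_mul_I]
  · refine (integrable_const (1 : ℝ)).mono' (Measurable.aestronglyMeasurable (by fun_prop))
      (ae_of_all _ fun ω => ?_)
    rw [Real.norm_of_nonneg (le_min zero_le_one (hS0 ω))]
    exact min_le_left _ _
  · rw [← h.integral_exp_neg hρ hmin ht, integral_sub ?_ (integrable_const _)]
    · simp
    · refine (integrable_const (1 : ℝ)).mono' (Measurable.aestronglyMeasurable (by fun_prop))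
        (ae_of_all _ fun ω => ?_)
      rw [Real.norm_of_nonneg (Real.exp_nonneg _), Real.exp_le_one_iff]
      nlinarith [hS0 ω, _root_.mul_nonneg ht.le (hS0 ω)]

end Series

/-! ### Infinite divisibility and the representation -/

lemma HasLevyCharFun.charFun_map {Ω : Type*} [MeasurableSpace Ω] {ρ : Measure PosReal} {X : Ω → ℝ}
    {P : Measure Ω} (h : HasLevyCharFun ρ X P) (hX : Measurable X) (u : ℝ) :
    charFun (P.map X) u
      = Complex.exp (∫ x : PosReal, (Complex.exp (Complex.I * u * ((x : ℝ) : ℂ)) - 1) ∂ρ) := by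
  rw [charFun_apply_real, integral_map hX.aemeasurable
    (Measurable.aestronglyMeasurable (by fun_prop)), ← h u]
  congr with ω
  congr 1
  ring

/-- Scaling `ν` by 1/n scales `ρ` by 1/n, so the series for the scaled process has the n-th root of
the characteristic function and serves as the law of one summand. -/
theorem IsMarkedPoissonPoints.isInfinitelyDivisible {Ω : Type*} [MeasurableSpace Ω]
    {ν F ρ : Measure PosReal} {p : ℕ → Ω → ℝ} {W : ℕ → Ω → PosReal} {P : Measure Ω}
    [IsFiniteMeasureOnCompacts ν] [IsProbabilityMeasure F] [IsProbabilityMeasure P]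
    (h : IsMarkedPoissonPoints ν F p W P)
    (hρ : ∀ A : Set PosReal, MeasurableSet A →
      ρ A = ∫⁻ y, ∫⁻ w, A.indicator (fun _ => (1 : ℝ≥0∞)) (w * y) ∂F ∂ν)
    (hmin : ∫⁻ x : PosReal, min 1 (ENNReal.ofReal x) ∂ρ < ∞) :
    IsInfinitelyDivisible (P.map fun ω => ∑' i, p i ω * (W i ω : ℝ)) := by
  refine ⟨Measure.isProbabilityMeasure_map h.measurable_tsum.aemeasurable, fun n hn => ?_⟩
  have hn0 : (n : ℝ≥0∞) ≠ 0 := by simpa using Nat.one_le_iff_ne_zero.1 hn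
  have hinv : (n : ℝ≥0∞)⁻¹ ≠ ∞ := ENNReal.inv_ne_top.2 hn0
  have : IsFiniteMeasureOnCompacts ((n : ℝ≥0∞)⁻¹ • ν) := ⟨fun K hK => by
    simpa using ENNReal.mul_lt_top hinv.lt_top hK.measure_lt_top⟩
  obtain ⟨Ω', _, P', p', W', hP', h', -⟩ := exists_isMarkedPoissonPoints ((n : ℝ≥0∞)⁻¹ • ν) F
  have hchar := h'.hasLevyCharFun (ρ := (n : ℝ≥0∞)⁻¹ • ρ)
    (fun A hA => by
      rw [lintegral_smul_measure, Measure.smul_apply, hρ A hA])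
    (by
      rw [lintegral_smul_measure]
      exact ENNReal.mul_lt_top hinv.lt_top hmin)
  have hμn := Measure.isProbabilityMeasure_map (μ := P') h'.measurable_tsum.aemeasurable
  have hsum : Measurable fun x : Fin n → ℝ => ∑ i, x i := by fun_prop
  have := Measure.isProbabilityMeasure_map (μ := P) h.measurable_tsum.aemeasurable
  have := Measure.isProbabilityMeasure_map (μ := Measure.pi fun _ : Fin n =>
    P'.map fun ω => ∑' i, p' i ω * (W' i ω : ℝ)) hsum.aemeasurable
  refine ⟨P'.map fun ω => ∑' i, p' i ω * (W' i ω : ℝ), hμn, Measure.ext_of_charFun ?_⟩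
  ext u
  rw [charFun_map_sum_pi_eq_prod, Finset.prod_apply, Finset.prod_const, Finset.card_univ,
    Fintype.card_fin, hchar.charFun_map h'.measurable_tsum,
    (h.hasLevyCharFun hρ hmin).charFun_map h.measurable_tsum, ← Complex.exp_nat_mul,
    integral_smul_measure]
  congr 1
  have hn' : (n : ℂ) ≠ 0 := by exact_mod_cast Nat.one_le_iff_ne_zero.1 hn
  simp [hn']

theorem mainTheorem6 (ν F ρ : Measure PosReal) [IsFiniteMeasureOnCompacts ν]
    [IsProbabilityMeasure F]
    (hρ : ∀ A : Set PosReal, MeasurableSet A →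
      ρ A = ∫⁻ y, ∫⁻ w, A.indicator (fun _ => (1 : ℝ≥0∞)) (w * y) ∂F ∂ν)
    (hLevy : IsLevyMeasure ρ)
    (hsmall : (∫⁻ x in {x : PosReal | (x : ℝ) ≤ 1}, ENNReal.ofReal (x : ℝ) ∂ρ) < ∞) :
    (∃ (Ω : Type) (_ : MeasurableSpace Ω) (P : Measure Ω) (p : ℕ → Ω → ℝ) (W : ℕ → Ω → PosReal),
      IsProbabilityMeasure P ∧ IsMarkedPoissonPoints ν F p W P ∧
        ∀ i ω, p i ω = 0 → p (i + 1) ω = 0) ∧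
    ∀ {Ω : Type*} [MeasurableSpace Ω] (P : Measure Ω) [IsProbabilityMeasure P]
      (p : ℕ → Ω → ℝ) (W : ℕ → Ω → PosReal), IsMarkedPoissonPoints ν F p W P →
      (∀ᵐ ω ∂P, Summable fun i => p i ω * (W i ω : ℝ)) ∧
      IsInfinitelyDivisible (P.map fun ω => ∑' i, p i ω * (W i ω : ℝ)) ∧
      HasLevyCharFun ρ (fun ω => ∑' i, p i ω * (W i ω : ℝ)) P ∧
      ∀ {Ω' : Type*} [MeasurableSpace Ω'] (P' : Measure Ω') [IsProbabilityMeasure P']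
        (X : Ω' → ℝ), Measurable X → IsInfinitelyDivisible (P'.map X) → HasLevyCharFun ρ X P' →
        IdentDistrib X (fun ω => ∑' i, p i ω * (W i ω : ℝ)) P' P := by
  have hmin := lintegral_min_one_lt_top hLevy hsmall
  refine ⟨exists_isMarkedPoissonPoints ν F, fun P _ p W h => ⟨h.ae_summable hρ hmin,
    h.isInfinitelyDivisible hρ hmin, h.hasLevyCharFun hρ hmin, fun P' _ X hX _ hXchar =>
      ⟨hX.aemeasurable, h.measurable_tsum.aemeasurable, ?_⟩⟩⟩
  have := Measure.isProbabilityMeasure_map (μ := P') hX.aemeasurable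
  have := Measure.isProbabilityMeasure_map (μ := P) h.measurable_tsum.aemeasurable
  refine Measure.ext_of_charFun ?_
  ext u
  rw [hXchar.charFun_map hX, (h.hasLevyCharFun hρ hmin).charFun_map h.measurable_tsum]
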